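/- **Setting.** Let $\mathbb S^m$ be the space of real symmetric $m\times m$ matrices. For $X\in\mathbb R^{m\times m}$ with singular values $\sigma_1\ge\dots\ge\sigma_m\ge 0$ put $\|X\|_{S_p}=(\sum_j\sigma_j^p)^{1/p}$ for $0<p<\infty$, let $\|X\|_{S_\infty}=\sigma_1$ be the operator norm, and put $\langle X,Y\rangle=\operatorname{tr}(X^TY)$. For $z\in\mathbb R^N$ put $\|z\|_q=(\sum_j|z_j|^q)^{1/q}$. Let $\beta^1,\dots,\beta^L\in\mathbb R^m$ and $A_j=\beta^j(\beta^j)^T$ (symmetric rank-one projections). Let $\tilde L=\lfloor L/2\rfloor$, $\tilde A_j=A_{2j-1}-A_{2j}$ for $1\le j\le\tilde L$, and $\tilde{\mathcal A}:\mathbb S^m\to\mathbb R^{\tilde L}$, $[\tilde{\mathcal A}(X)]_j=\langle\tilde A_j,X\rangle$, with adjoint $\tilde{\mathcal A}^*(z)=\sum_j z_j\tilde A_j$. For $b\in\mathbb R^L$ let $\tilde b_j=b_{2j-1}-b_{2j}$. For $0<q\le 1$ and constants $C_1>0$, $C_2$, the map $\tilde{\mathcal A}$ satisfies $\ell_q$-RUB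 of order $t$ with constants $C_1,C_2$ if $C_1\|X\|_{S_2}^q\le\|\tilde{\mathcal A}(X)\|_q^q/\tilde L\le C_2\|X\|_{S_2}^q$ for all nonzero $X\in\mathbb S^m$ of rank at most $t$. For $\mathcal B\subset\mathbb R^{\tilde L}$ consider the Schatten-$p$ minimization $$(\mathrm P_{\mathcal B})\qquad \min_{X\in\mathbb S^m}\|X\|_{S_p}^p\quad\text{subject to}\quad \tilde b-\tilde{\mathcal A}(X)\in\mathcal B,$$ and put $\mathcal B(\eta_1,\eta_2)=\{z:\|z\|_q/\tilde L\le\eta_1\}\cap\{z:\|\tilde{\mathcal A}^*(z)\|_{S_\infty}\le\eta_2\}$. **Statement.** Let $0<p\le q\le 1$, let $r$ be a positive integer, and let $k>1$ be real with $kr$ an integer. Suppose that $\tilde{\mathcal A}$ satisfies $\ell_q$-RUB of order $(k+1)r$ with constants $C_1>0$ and $C_2$. Put $a=(1/k)^{(1/p-1/2)q}$, $\rho_1=C_1-C_2a$ and $\rho_2=C_1-C_2\,2^{q/p-1}a$. 1. (Exact recovery.) If $C_2/C_1<k^{(1/p-1/2)q}$, then for every $X\in\mathbb S^m$ of rank at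 most $r$ and every $b$ with $\tilde b=\tilde{\mathcal A}(X)$, the matrix $X$ is the unique solution of $(\mathrm P_{\{0\}})$. 2. (Stable recovery, low rank.) If $C_2/C_1<k^{(1/p-1/2)q}$, then for all $\eta_1,\eta_2$, every $X\in\mathbb S^m$ of rank at most $r$, every $b$ with $\tilde b-\tilde{\mathcal A}(X)\in\mathcal B(\eta_1,\eta_2)$ and every solution $\hat X$ of $(\mathrm P_{\mathcal B(\eta_1,\eta_2)})$, $$\|\hat X-X\|_{S_2}^q\le (a+1)\frac1{\rho_1\tilde L^q}\min\Big\{\frac{2}{\tilde L^{1-2q}}\eta_1^q,\ \frac{2^{q/p+q}}{\rho_1}r^{(1/p-1/2)q}\eta_2^q\Big\}.$$ 3. (Stable recovery, general.) If $k>2^{\frac{2(q-p)}{q(2-p)}}$ and $C_2/C_1<2^{1-q/p}k^{(1/p-1/2)q}$, then for all $\eta_1,\eta_2$, every $X\in\mathbb S^m$, every best rank-$r$ approximation $X_{\max(r)}$ of $X$ in the norm $\|\cdot\|_{S_2}$, every $b$ with $\tilde b-\tilde{\mathcal A}(X)\in\mathcal B(\eta_1,\eta_2)$ and every solution $\hat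 X$ of $(\mathrm P_{\mathcal B(\eta_1,\eta_2)})$, with $X_{-\max(r)}=X-X_{\max(r)}$ and $y=\big(\|X_{-\max(r)}\|_{S_p}/r^{1/p-1/2}\big)^q$, the quantity $\|\hat X-X\|_{S_2}^q$ is at most each of $$\Big(\frac{C_2 2^{2q/p-1}}{\rho_2}a+1\Big)\big(2^{2q/p-1}a+1\big)\,y+\big(2^{q/p-1}a+1\big)\frac{1}{\rho_2\tilde L^q}\cdot\frac{2}{\tilde L^{1-2q}}\eta_1^q$$ and $$\Big(\frac{C_2 2^{2q/p}}{\rho_2}a+\frac32\Big)\big(2^{2q/p-1}a+1\big)\,y+\big(2^{q/p-1}a+1\big)\frac{1}{\rho_2\tilde L^q}\cdot\frac{2^{2q/p+q+1}}{\rho_2}r^{(1/p-1/2)q}\eta_2^q .$$ -/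

import Mathlib

open Matrix

noncomputable section

/-- The `i`-th largest singular value of `X` (zero-indexed, equal to `0` for `i ≥ m`). -/
def singVal {m : ℕ} (X : Matrix (Fin m) (Fin m) ℝ) (i : ℕ) : ℝ :=
  (Matrix.toEuclideanLin X).singularValues i

/-- The Schatten `p`-(quasi-)norm `(∑ i, σ i ^ p) ^ (1 / p)`. -/
def schatten {m : ℕ} (p : ℝ) (X : Matrix (Fin m) (Fin m) ℝ) : ℝ :=
  (∑ i : Fin m, singVal X i ^ p) ^ (1 / p)

/-- The Schatten `∞`-norm, that is, the operator norm for the Euclidean norm. -/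
def schattenInf {m : ℕ} (X : Matrix (Fin m) (Fin m) ℝ) : ℝ :=
  ‖Matrix.toEuclideanCLM (n := Fin m) (𝕜 := ℝ) X‖

/-- The `ℓ_q`-(quasi-)norm on `ℝ^N`. -/
def lqNorm {N : ℕ} (q : ℝ) (z : Fin N → ℝ) : ℝ :=
  (∑ j, |z j| ^ q) ^ (1 / q)

/-- The linear map `X ↦ (⟨A j, X⟩)_j` with `⟨A, X⟩ = trace (Aᵀ X)`. -/
def measOp {m N : ℕ} (A : Fin N → Matrix (Fin m) (Fin m) ℝ) :
    Matrix (Fin m) (Fin m) ℝ →ₗ[ℝ] (Fin N → ℝ) where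
  toFun X := fun j => Matrix.trace ((A j)ᵀ * X)
  map_add' X Y := by
    funext j
    simp [Matrix.mul_add]
  map_smul' c X := by
    funext j
    simp

/-- The adjoint `z ↦ ∑ j, z j • A j` of `measOp A`. -/
def measOpAdj {m N : ℕ} (A : Fin N → Matrix (Fin m) (Fin m) ℝ) (z : Fin N → ℝ) :
    Matrix (Fin m) (Fin m) ℝ :=
  ∑ j, z j • A j

theorem measOpAdj_spec {m N : ℕ} (A : Fin N → Matrix (Fin m) (Fin m) ℝ)
    (X : Matrix (Fin m) (Fin m) ℝ) (z : Fin N → ℝ) :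
    ∑ j, measOp A X j * z j = Matrix.trace ((measOpAdj A z)ᵀ * X) := by
  simp [measOp, measOpAdj, Matrix.transpose_sum, Matrix.sum_mul, Matrix.trace_sum, mul_comm]

/-- The measurement matrices `A j = β j (β j)ᵀ` of symmetric rank-one projections. -/
def srop {m L : ℕ} (β : Fin L → Fin m → ℝ) (j : Fin L) : Matrix (Fin m) (Fin m) ℝ :=
  Matrix.vecMulVec (β j) (β j)

/-- Differences of consecutive pairs: with one-based indices, `ã_j = a_{2j-1} - a_{2j}` for
`j = 1, …, ⌊L/2⌋`. -/
def debias {M : Type*} [AddGroup M] {L : ℕ} (a : Fin L → M) (j : Fin (L / 2)) : M :=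
  a ⟨2 * (j : ℕ), by have := j.isLt; omega⟩ - a ⟨2 * (j : ℕ) + 1, by have := j.isLt; omega⟩

/-- `ℓ_q`-restricted uniform boundedness of order `r` with constants `C₁`, `C₂` for the map
`measOp A` on the space of symmetric matrices. -/
def SymmRUB {m N : ℕ} (A : Fin N → Matrix (Fin m) (Fin m) ℝ) (q : ℝ) (r : ℕ) (C₁ C₂ : ℝ) :
    Prop :=
  ∀ X : Matrix (Fin m) (Fin m) ℝ, X.IsSymm → X ≠ 0 → X.rank ≤ r →
    C₁ * schatten 2 X ^ q ≤ lqNorm q (measOp A X) ^ q / N ∧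
      lqNorm q (measOp A X) ^ q / N ≤ C₂ * schatten 2 X ^ q

/-- `ℓ_q`-bounded noise. -/
def lqBall (N : ℕ) (q η : ℝ) : Set (Fin N → ℝ) :=
  {z | lqNorm q z / N ≤ η}

/-- Noise bounded in the sense of the Dantzig selector. -/
def dantzigBall {m N : ℕ} (A : Fin N → Matrix (Fin m) (Fin m) ℝ) (η : ℝ) : Set (Fin N → ℝ) :=
  {z | schattenInf (measOpAdj A z) ≤ η}

/-- `Xhat` solves `min ‖X‖_{S_p}^p` over symmetric `X` subject to `b - measOp A X ∈ B`. -/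
def IsSchattenMin {m N : ℕ} (A : Fin N → Matrix (Fin m) (Fin m) ℝ) (b : Fin N → ℝ)
    (B : Set (Fin N → ℝ)) (p : ℝ) (Xhat : Matrix (Fin m) (Fin m) ℝ) : Prop :=
  Xhat.IsSymm ∧ b - measOp A Xhat ∈ B ∧
    ∀ Y : Matrix (Fin m) (Fin m) ℝ, Y.IsSymm → b - measOp A Y ∈ B →
      schatten p Xhat ^ p ≤ schatten p Y ^ p

/-- `Z` is a best rank-`r` approximation of `X` in the Frobenius norm. -/
def IsBestRankApprox {m : ℕ} (r : ℕ) (X Z : Matrix (Fin m) (Fin m) ℝ) : Prop :=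
  Z.rank ≤ r ∧ ∀ W : Matrix (Fin m) (Fin m) ℝ, W.rank ≤ r → schatten 2 (X - Z) ≤ schatten 2 (X - W)

end

/-! Let `H` be the difference between a minimizer and `X`. Its spectral decomposition, ordered by
singular values, is cut into a head of `r + s = (k+1)r` components and tail blocks of `s = kr`
components. With `t` the `q`-th power of the Frobenius norm of the head, `w` the normalized `ℓ_q`
size of the measurements of `H`, and `Q` the sum of the `q`-th powers of the block norms, the lower
RUB bound on the head, the upper one on the blocks and the `q`-triangle inequality give `C₁ t ≤ w +
C₂ Q`, while the whole error is at most `t + Q` (`SymmRUB.block_bounds`). Since the singular values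
decrease, each block is controlled by its predecessor, so `Q` is bounded by `s ^ (-(1/p - 1/2) q)`
times a power of the `p`-sum of the singular values of index at least `r` (`sum_blocks_sq_rpow_le`).

Minimality bounds that `p`-sum by the one over the first `r` indices plus twice the approximation
error (`sum_tail_singVal_rpow_le`), and Hölder bounds the first `r` indices by `t`. For low rank
this reads `Q ≤ a t`, hence `ρ₁ t ≤ w`; in general convexity of `u ^ (q/p)` costs powers of two.
Finally `w` is bounded by the noise: directly for the `ℓ_q` ball, and by duality of the operator and
trace norms for the Dantzig constraint, where `w ^ 2` is at most linear in `t`.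

The deep ingredient is the perturbation inequality `∑ |σᵢ(A)^p - σᵢ(B)^p| ≤ ∑ σᵢ(A - B)^p`
(`sum_abs_singVal_rpow_sub_le`). For symmetric matrices it reduces to semidefinite rank-one changes:
there the singular values interlace, their total variation is at most the trace, and concavity makes
increments over disjoint intervals largest next to the origin. -/

open Module

/-! ### Min-max comparison and singular values -/

/-- One direction of the Courant–Fischer principle, for forms compared on the kernel of a map
of small rank. -/
theorem LinearMap.IsSymmetric.eigenvalues_add_le {E G : Type*} [NormedAddCommGroup E]
    [InnerProductSpace ℝ E] [FiniteDimensional ℝ E] [AddCommGroup G] [Module ℝ G]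
    {n : ℕ} (hn : finrank ℝ E = n) {S T : E →ₗ[ℝ] E} (hS : S.IsSymmetric) (hT : T.IsSymmetric)
    {k : ℕ} (Φ : E →ₗ[ℝ] G) (hΦ : finrank ℝ (LinearMap.range Φ) ≤ k)
    (h : ∀ x, Φ x = 0 → inner ℝ (T x) x ≤ inner ℝ (S x) x) (i j : Fin n)
    (hij : (j : ℕ) = i + k) : hT.eigenvalues hn j ≤ hS.eigenvalues hn i := by
  set bT := hT.eigenvectorBasis hn with hbT
  set bS := hS.eigenvectorBasis hn with hbS
  -- The target has dimension at most `k + (n - 1 - j) + i = n - 1`, so some nonzero `x` is killed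
  -- by `Φ`, orthogonal to the eigenvectors of `T` beyond `j` and to those of `S` before `i`.
  let F : E →ₗ[ℝ] (LinearMap.range Φ × (Finset.Ioi j → ℝ) × (Finset.Iio i → ℝ)) :=
    Φ.rangeRestrict.prod
      ((LinearMap.pi fun l => (innerₛₗ ℝ (bT l.1))).prod
        (LinearMap.pi fun l => (innerₛₗ ℝ (bS l.1))))
  have hker : LinearMap.ker F ≠ ⊥ := by
    apply LinearMap.ker_ne_bot_of_finrank_lt
    have h1 := i.2
    have h2 := j.2
    simp only [finrank_prod, finrank_pi, Fintype.card_coe, Fin.card_Ioi, Fin.card_Iio, hn]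
    omega
  obtain ⟨x, hx, hx0⟩ := (Submodule.ne_bot_iff _).1 hker
  have hF : F x = 0 := hx
  have hx1 := congrArg Prod.fst hF
  have hx2 := congrArg (fun z => z.2.1) hF
  have hx3 := congrArg (fun z => z.2.2) hF
  have hx1' : Φ x = 0 := congrArg Subtype.val hx1
  have hx2' : ∀ l, j < l → inner ℝ (bT l) x = 0 := fun l hl => by
    simpa using! congrFun hx2 ⟨l, by simpa using hl⟩
  have hx3' : ∀ l, l < i → inner ℝ (bS l) x = 0 := fun l hl => by
    simpa using! congrFun hx3 ⟨l, by simpa using hl⟩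
  have key : ∀ {R : E →ₗ[ℝ] E} (hR : R.IsSymmetric),
      inner ℝ (R x) x =
        ∑ l, hR.eigenvalues hn l * inner ℝ (hR.eigenvectorBasis hn l) x ^ 2 := by
    intro R hR
    rw [← (hR.eigenvectorBasis hn).sum_inner_mul_inner (R x) x]
    refine Finset.sum_congr rfl fun l _ => ?_
    rw [hR, hR.apply_eigenvectorBasis, real_inner_comm]
    simp only [RCLike.ofReal_real_eq_id, id_eq, inner_smul_left]
    simp
    ring
  have nrm : ∀ b : OrthonormalBasis (Fin n) ℝ E, ‖x‖ ^ 2 = ∑ l, inner ℝ (b l) x ^ 2 := by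
    intro b
    rw [← real_inner_self_eq_norm_sq, ← b.sum_inner_mul_inner x x]
    refine Finset.sum_congr rfl fun l _ => ?_
    rw [real_inner_comm, sq]
  have hpos : 0 < ‖x‖ ^ 2 := by positivity
  have e1 : hT.eigenvalues hn j * ‖x‖ ^ 2 ≤ inner ℝ (T x) x := by
    rw [key hT, nrm bT, Finset.mul_sum]
    refine Finset.sum_le_sum fun l _ => ?_
    rcases lt_or_ge j l with hl | hl
    · rw [← hbT, hx2' l hl]; simp
    · exact mul_le_mul_of_nonneg_right (hT.eigenvalues_antitone hn hl) (sq_nonneg _)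
  have e2 : inner ℝ (S x) x ≤ hS.eigenvalues hn i * ‖x‖ ^ 2 := by
    rw [key hS, nrm bS, Finset.mul_sum]
    refine Finset.sum_le_sum fun l _ => ?_
    rcases lt_or_ge l i with hl | hl
    · rw [← hbS, hx3' l hl]; simp
    · exact mul_le_mul_of_nonneg_right (hS.eigenvalues_antitone hn hl) (sq_nonneg _)
  exact le_of_mul_le_mul_right (e1.trans ((h x hx1').trans e2)) hpos

theorem singVal_nonneg {m : ℕ} (X : Matrix (Fin m) (Fin m) ℝ) (i : ℕ) : 0 ≤ singVal X i :=
  LinearMap.singularValues_nonneg _ _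

theorem singVal_antitone {m : ℕ} (X : Matrix (Fin m) (Fin m) ℝ) : Antitone (singVal X) :=
  LinearMap.singularValues_antitone _

theorem singVal_of_le {m : ℕ} (X : Matrix (Fin m) (Fin m) ℝ) {i : ℕ} (hi : m ≤ i) :
    singVal X i = 0 :=
  LinearMap.singularValues_of_finrank_le _ (by simpa using hi)

/-- If `‖B x‖ ≤ ‖A x‖` on the kernel of a matrix of rank at most `k`, the singular values of `B`
shifted by `k` are bounded by those of `A`. -/
theorem singVal_add_le {m k : ℕ} {A B Φ : Matrix (Fin m) (Fin m) ℝ} (hΦ : Φ.rank ≤ k)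
    (h : ∀ x, toEuclideanLin Φ x = 0 → ‖toEuclideanLin B x‖ ≤ ‖toEuclideanLin A x‖) (i : ℕ) :
    singVal B (i + k) ≤ singVal A i := by
  rcases le_or_gt m (i + k) with hi | hi
  · rw [singVal_of_le B hi]; exact singVal_nonneg _ _
  have hfin : finrank ℝ (EuclideanSpace ℝ (Fin m)) = m := by simp
  unfold singVal
  rw [LinearMap.singularValues_of_lt _ hfin hi,
    LinearMap.singularValues_of_lt _ hfin (show i < m by omega)]
  refine Real.sqrt_le_sqrt (LinearMap.IsSymmetric.eigenvalues_add_le hfin _ _ (k := k) (toEuclideanLin Φ)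
    ?_ ?_ _ _ rfl)
  · rw [Matrix.rank_eq_finrank_range_toLin Φ (EuclideanSpace.basisFun _ ℝ).toBasis
      (EuclideanSpace.basisFun _ ℝ).toBasis] at hΦ
    exact hΦ
  · intro x hx
    simp only [LinearMap.comp_apply, LinearMap.adjoint_inner_left, real_inner_self_eq_norm_sq]
    have := h x hx
    gcongr

theorem singVal_le {m : ℕ} {A B : Matrix (Fin m) (Fin m) ℝ}
    (h : ∀ x, ‖toEuclideanLin B x‖ ≤ ‖toEuclideanLin A x‖) (i : ℕ) :
    singVal B i ≤ singVal A i :=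
  singVal_add_le (Φ := 0) (k := 0) (by simp) (fun x _ => h x) i

theorem singVal_congr_of_transpose_mul {m : ℕ} {A B : Matrix (Fin m) (Fin m) ℝ}
    (h : Aᵀ * A = Bᵀ * B) (i : ℕ) : singVal A i = singVal B i := by
  have : ∀ x, ‖toEuclideanLin B x‖ = ‖toEuclideanLin A x‖ := by
    intro x
    have e : ∀ C : Matrix (Fin m) (Fin m) ℝ,
        ‖toEuclideanLin C x‖ ^ 2 = inner ℝ (toEuclideanLin (Cᵀ * C) x) x := by
      intro C
      rw [← Matrix.conjTranspose_eq_transpose_of_trivial, toLpLin_mul_same,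
        toEuclideanLin_conjTranspose_eq_adjoint, LinearMap.comp_apply,
        LinearMap.adjoint_inner_left, real_inner_self_eq_norm_sq]
    have := (e B).trans ((congrArg (fun M => inner ℝ (toEuclideanLin M x) x) h.symm).trans
      (e A).symm)
    exact (sq_eq_sq₀ (norm_nonneg _) (norm_nonneg _)).1 this
  exact le_antisymm (singVal_le (fun x => (this x).ge) i) (singVal_le (fun x => (this x).le) i)

/-- The multiset of squared singular values is the multiset of roots of the characteristic
polynomial of `Xᵀ X`. -/
theorem roots_charpoly_transpose_mul_self {m : ℕ} (X : Matrix (Fin m) (Fin m) ℝ) :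
    (Xᵀ * X).charpoly.roots =
      Multiset.map (fun i : Fin m => singVal X i ^ 2) Finset.univ.val := by
  have hfin : finrank ℝ (EuclideanSpace ℝ (Fin m)) = m := by simp
  have e : (Xᵀ * X).charpoly =
      (LinearMap.adjoint (toEuclideanLin X) ∘ₗ toEuclideanLin X).charpoly := by
    rw [← toEuclideanLin_conjTranspose_eq_adjoint, ← toLpLin_mul_same,
      Matrix.conjTranspose_eq_transpose_of_trivial]
    exact (Matrix.charpoly_toLin _ (EuclideanSpace.basisFun _ ℝ).toBasis).symm
  rw [e, (toEuclideanLin X).isSymmetric_adjoint_comp_self.roots_charpoly_eq_eigenvalues hfin]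
  refine Multiset.map_congr rfl fun i _ => ?_
  simp only [singVal, LinearMap.sq_singularValues_fin _ hfin]
  rfl

/-! ### Symmetric matrices with prescribed spectral data -/

/-- The symmetric matrix with spectral data `U`, `c`. -/
def specMat {m : ℕ} (U : Matrix (Fin m) (Fin m) ℝ) (c : Fin m → ℝ) : Matrix (Fin m) (Fin m) ℝ :=
  U * diagonal c * Uᵀ

section specMat

variable {m : ℕ} {U V : Matrix (Fin m) (Fin m) ℝ}

theorem specMat_isSymm (U : Matrix (Fin m) (Fin m) ℝ) (c : Fin m → ℝ) : (specMat U c).IsSymm := by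
  simp [specMat, IsSymm, Matrix.transpose_mul, Matrix.mul_assoc]

theorem specMat_add (U : Matrix (Fin m) (Fin m) ℝ) (c d : Fin m → ℝ) :
    specMat U (c + d) = specMat U c + specMat U d := by
  rw [specMat, specMat, specMat, ← Matrix.add_mul, ← Matrix.mul_add, diagonal_add]
  rfl

theorem specMat_zero (U : Matrix (Fin m) (Fin m) ℝ) : specMat U 0 = 0 := by
  have : diagonal (0 : Fin m → ℝ) = 0 := diagonal_zero
  simp [specMat, this]

theorem specMat_sum {ι : Type*} (U : Matrix (Fin m) (Fin m) ℝ) (s : Finset ι)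
    (c : ι → Fin m → ℝ) : specMat U (∑ j ∈ s, c j) = ∑ j ∈ s, specMat U (c j) := by
  classical
  induction s using Finset.induction_on with
  | empty => simp [specMat_zero]
  | insert a s ha ih => rw [Finset.sum_insert ha, Finset.sum_insert ha, specMat_add, ih]

theorem specMat_mul (hU : Uᵀ * U = 1) (c d : Fin m → ℝ) :
    specMat U c * specMat U d = specMat U (c * d) := by
  have : specMat U c * specMat U d = U * diagonal c * (Uᵀ * U) * diagonal d * Uᵀ := by
    simp only [specMat, Matrix.mul_assoc]
  rw [this, hU, Matrix.mul_one, Matrix.mul_assoc U, diagonal_mul_diagonal]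
  rfl

theorem specMat_charpoly (hU : Uᵀ * U = 1) (c : Fin m → ℝ) :
    (specMat U c).charpoly.roots = Multiset.map c Finset.univ.val := by
  rw [specMat, Matrix.charpoly_mul_comm, ← Matrix.mul_assoc, hU, Matrix.one_mul,
    charpoly_diagonal, Polynomial.roots_prod _ _ (Finset.prod_ne_zero_iff.2
      fun i _ => Polynomial.X_sub_C_ne_zero _)]
  simp

theorem specMat_transpose_mul_self (hU : Uᵀ * U = 1) (c : Fin m → ℝ) :
    (specMat U c)ᵀ * specMat U c = specMat U (c * c) := by
  rw [(specMat_isSymm U c).eq, specMat_mul hU]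

/-- The singular values of `specMat U c` are the absolute values of `c`, up to order. -/
theorem map_singVal_specMat (hU : Uᵀ * U = 1) (c : Fin m → ℝ) :
    Multiset.map (fun i : Fin m => singVal (specMat U c) i) Finset.univ.val =
      Multiset.map (fun i => |c i|) Finset.univ.val := by
  have h := roots_charpoly_transpose_mul_self (specMat U c)
  rw [specMat_transpose_mul_self hU, specMat_charpoly hU] at h
  have := congrArg (Multiset.map Real.sqrt) h
  rw [Multiset.map_map, Multiset.map_map] at this
  simpa [Function.comp_def, Real.sqrt_sq (singVal_nonneg _ _), Real.sqrt_mul_self_eq_abs] using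
    this.symm

theorem sum_singVal_specMat (hU : Uᵀ * U = 1) (c : Fin m → ℝ) (f : ℝ → ℝ) :
    ∑ i : Fin m, f (singVal (specMat U c) i) = ∑ i, f |c i| := by
  have := congrArg (fun M => (Multiset.map f M).sum) (map_singVal_specMat hU c)
  simp only [Multiset.map_map, Function.comp_def] at this
  exact this

/-- Two nonincreasing lists with the same multiset of entries coincide. -/
theorem singVal_specMat_of_antitone (hU : Uᵀ * U = 1) (c : Fin m → ℝ)
    (hc : Antitone fun i => |c i|) (i : Fin m) : singVal (specMat U c) i = |c i| := by
  have h := map_singVal_specMat hU c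
  simp only [Fin.univ_val_map, Multiset.coe_eq_coe] at h
  have h1 : (List.ofFn fun i : Fin m => singVal (specMat U c) i).SortedGE := by
    refine Antitone.sortedGE_ofFn fun a b hab => singVal_antitone _ hab
  have h2 : (List.ofFn fun i : Fin m => |c i|).SortedGE := Antitone.sortedGE_ofFn hc
  have := h.eq_of_sortedGE h1 h2
  exact congrFun (List.ofFn_injective this) i

theorem norm_specMat_sq (hU : Uᵀ * U = 1) (c : Fin m → ℝ) (x : EuclideanSpace ℝ (Fin m)) :
    ‖toEuclideanLin (specMat U c) x‖ ^ 2 = ∑ i, c i ^ 2 * (Uᵀ *ᵥ x.ofLp) i ^ 2 := by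
  have e : ‖toEuclideanLin (specMat U c) x‖ ^ 2 =
      (specMat U c *ᵥ x.ofLp) ⬝ᵥ (specMat U c *ᵥ x.ofLp) := by
    rw [EuclideanSpace.norm_sq_eq]
    simp [dotProduct, sq]
  rw [e, Matrix.dotProduct_mulVec, ← Matrix.mulVec_transpose, Matrix.mulVec_mulVec,
    specMat_transpose_mul_self hU, specMat, ← Matrix.mulVec_mulVec, ← Matrix.mulVec_mulVec,
    dotProduct_comm, Matrix.dotProduct_mulVec, ← Matrix.mulVec_transpose]
  simp only [dotProduct, mulVec_diagonal, Pi.mul_apply]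
  exact Finset.sum_congr rfl fun i _ => by ring

theorem singVal_specMat_le (hU : Uᵀ * U = 1) {c d : Fin m → ℝ} (h : ∀ i, |c i| ≤ |d i|) (j : ℕ) :
    singVal (specMat U c) j ≤ singVal (specMat U d) j := by
  refine singVal_le (fun x => ?_) j
  refine le_of_sq_le_sq ?_ (norm_nonneg _)
  rw [norm_specMat_sq hU, norm_specMat_sq hU]
  exact Finset.sum_le_sum fun i _ => mul_le_mul_of_nonneg_right (sq_le_sq.2 (h i)) (sq_nonneg _)

theorem singVal_specMat_eq (hU : Uᵀ * U = 1) (hV : Vᵀ * V = 1) (c : Fin m → ℝ) (i : Fin m) :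
    singVal (specMat U c) i = singVal (specMat V c) i := by
  have h := (map_singVal_specMat hU c).trans (map_singVal_specMat hV c).symm
  simp only [Fin.univ_val_map, Multiset.coe_eq_coe] at h
  have := h.eq_of_sortedGE (Antitone.sortedGE_ofFn fun a b hab => singVal_antitone _ hab)
    (Antitone.sortedGE_ofFn fun a b hab => singVal_antitone _ hab)
  exact congrFun (List.ofFn_injective this) i

theorem rank_specMat_le (U : Matrix (Fin m) (Fin m) ℝ) (c : Fin m → ℝ) (s : Finset (Fin m))
    (hs : ∀ i ∉ s, c i = 0) : (specMat U c).rank ≤ s.card := by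
  refine (Matrix.rank_mul_le_left _ _).trans ((Matrix.rank_mul_le_right _ _).trans ?_)
  rw [Matrix.rank_diagonal, Fintype.card_subtype]
  refine Finset.card_le_card fun i hi => ?_
  by_contra h
  exact (Finset.mem_filter.1 hi).2 (hs i h)

end specMat

theorem Matrix.IsSymm.isHermitian_real {m : ℕ} {X : Matrix (Fin m) (Fin m) ℝ} (h : X.IsSymm) :
    X.IsHermitian := by
  rw [IsHermitian, conjTranspose_eq_transpose_of_trivial]; exact h

theorem Matrix.IsHermitian.exists_specMat {m : ℕ} {X : Matrix (Fin m) (Fin m) ℝ}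
    (h : X.IsHermitian) :
    ∃ U : Matrix (Fin m) (Fin m) ℝ, Uᵀ * U = 1 ∧ X = specMat U h.eigenvalues := by
  refine ⟨h.eigenvectorUnitary, ?_, ?_⟩
  · have := Unitary.coe_star_mul_self h.eigenvectorUnitary
    rwa [star_eq_conjTranspose, conjTranspose_eq_transpose_of_trivial] at this
  · conv_lhs => rw [h.spectral_theorem]
    rw [Unitary.conjStarAlgAut_apply, specMat, star_eq_conjTranspose,
      conjTranspose_eq_transpose_of_trivial]
    rfl

/-- Spectral decomposition of a symmetric matrix ordered by singular values. -/
theorem Matrix.IsSymm.exists_specMat {m : ℕ} {X : Matrix (Fin m) (Fin m) ℝ} (h : X.IsSymm) :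
    ∃ (U : Matrix (Fin m) (Fin m) ℝ) (c : Fin m → ℝ), Uᵀ * U = 1 ∧ X = specMat U c ∧
      ∀ i : Fin m, |c i| = singVal X i := by
  obtain ⟨U, hU, hX⟩ := h.isHermitian_real.exists_specMat
  set c := h.isHermitian_real.eigenvalues
  set σ := Tuple.sort (fun i => -|c i|)
  have hσ : Antitone fun i => |c (σ i)| := fun i j hij => by
    simpa using Tuple.monotone_sort (fun i => -|c i|) hij
  have hV : (U.submatrix id σ)ᵀ * U.submatrix id σ = 1 := by
    rw [transpose_submatrix, ← submatrix_mul _ _ _ _ _ Function.bijective_id, hU]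
    simp
  have hX' : X = specMat (U.submatrix id σ) (c ∘ σ) := by
    rw [hX, specMat, specMat, ← submatrix_diagonal_equiv, transpose_submatrix,
      submatrix_mul_equiv, submatrix_mul_equiv]
    simp
  refine ⟨_, c ∘ σ, hV, hX', fun i => ?_⟩
  rw [hX', singVal_specMat_of_antitone hV (c ∘ σ) hσ]

/-! ### Perturbation of concave powers of singular values -/

/-- The points `y` and `S + (x - y)` are convex combinations of `S` and `x` with exchanged weights;
the two concavity inequalities add up to the claim. It says that sliding an interval towards the
origin increases the increment of `u ^ p`. -/
theorem rpow_sub_rpow_le_shift {p S y x : ℝ} (hp : 0 < p) (hp1 : p ≤ 1) (hS : 0 ≤ S)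
    (hSy : S ≤ y) (hyx : y ≤ x) : x ^ p - y ^ p ≤ (S + (x - y)) ^ p - S ^ p := by
  rcases eq_or_lt_of_le (hSy.trans hyx) with h | h
  · have : y = x := le_antisymm hyx (h ▸ hSy)
    subst this; simp
  have hd : 0 < x - S := sub_pos.2 h
  have hc := (Real.concaveOn_rpow hp.le hp1).2
  have a0 : 0 ≤ (y - S) / (x - S) := div_nonneg (sub_nonneg.2 hSy) hd.le
  have b0 : 0 ≤ (x - y) / (x - S) := div_nonneg (sub_nonneg.2 hyx) hd.le
  have ab : (y - S) / (x - S) + (x - y) / (x - S) = 1 := by field_simp; ring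
  have hx : x ∈ Set.Ici (0 : ℝ) := by simp; linarith
  have hS' : S ∈ Set.Ici (0 : ℝ) := hS
  have h1 := hc hx hS' a0 b0 ab
  have h2 := hc hS' hx a0 b0 ab
  have e1 : ((y - S) / (x - S)) • x + ((x - y) / (x - S)) • S = y := by
    simp only [smul_eq_mul]; field_simp; ring
  have e2 : ((y - S) / (x - S)) • S + ((x - y) / (x - S)) • x = S + (x - y) := by
    simp only [smul_eq_mul]; field_simp; ring
  rw [e1] at h1
  rw [e2] at h2
  simp only [smul_eq_mul] at h1 h2
  have h3 : ∀ z : ℝ, (y - S) / (x - S) * z + (x - y) / (x - S) * z = z := fun z => by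
    rw [← add_mul, ab, one_mul]
  linarith [h3 (x ^ p), h3 (S ^ p)]

/-- The intervals `[l i, M i]` do not overlap and lie in `[0, M 0]`. -/
theorem sum_sub_le_of_interlacing (n : ℕ) (M l : ℕ → ℝ) (h0 : ∀ i, 0 ≤ l i)
    (h1 : ∀ i, l i ≤ M i) (h2 : ∀ i, M (i + 1) ≤ l i) :
    ∑ i ∈ Finset.range n, (M i - l i) ≤ M 0 := by
  induction n generalizing M l with
  | zero => simpa using (h0 0).trans (h1 0)
  | succ n ih =>
    rw [Finset.sum_range_succ']
    have := ih (fun i => M (i + 1)) (fun i => l (i + 1)) (fun i => h0 _) (fun i => h1 _)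
      (fun i => h2 _)
    linarith [h2 0]

/-- The increments of `x ^ p` over interlacing intervals are largest when the intervals are
pushed to the origin. -/
theorem sum_rpow_sub_rpow_le_of_interlacing {p : ℝ} (hp : 0 < p) (hp1 : p ≤ 1) (n : ℕ)
    (M l : ℕ → ℝ) (h0 : ∀ i, 0 ≤ l i) (h1 : ∀ i, l i ≤ M i) (h2 : ∀ i, M (i + 1) ≤ l i) :
    ∑ i ∈ Finset.range n, (M i ^ p - l i ^ p) ≤ (∑ i ∈ Finset.range n, (M i - l i)) ^ p := by
  induction n generalizing M l with
  | zero => simp [Real.zero_rpow hp.ne']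
  | succ n ih =>
    rw [Finset.sum_range_succ', Finset.sum_range_succ']
    have i1 := ih (fun i => M (i + 1)) (fun i => l (i + 1)) (fun i => h0 _) (fun i => h1 _)
      (fun i => h2 _)
    have i2 := sum_sub_le_of_interlacing n (fun i => M (i + 1)) (fun i => l (i + 1))
      (fun i => h0 _) (fun i => h1 _) (fun i => h2 _)
    -- The top interval slides down to start at the total length of the lower ones, which is at most
    -- `M 1 ≤ l 0`.
    have i3 := rpow_sub_rpow_le_shift hp hp1
      (Finset.sum_nonneg fun i _ => sub_nonneg.2 (h1 (i + 1))) (i2.trans (h2 0)) (h1 0)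
    linarith

theorem norm_toEuclideanLin_add_eq {m : ℕ} {A E : Matrix (Fin m) (Fin m) ℝ}
    (x : EuclideanSpace ℝ (Fin m)) (hx : toEuclideanLin E x = 0) :
    ‖toEuclideanLin (A + E) x‖ = ‖toEuclideanLin A x‖ := by
  rw [map_add, LinearMap.add_apply, hx, add_zero]

theorem singVal_add_rank_le {m k : ℕ} (A : Matrix (Fin m) (Fin m) ℝ)
    {E : Matrix (Fin m) (Fin m) ℝ} (hE : E.rank ≤ k) (i : ℕ) :
    singVal (A + E) (i + k) ≤ singVal A i ∧ singVal A (i + k) ≤ singVal (A + E) i :=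
  ⟨singVal_add_le hE (fun x hx => (norm_toEuclideanLin_add_eq x hx).le) i,
    singVal_add_le hE (fun x hx => (norm_toEuclideanLin_add_eq x hx).ge) i⟩

theorem eigenvalues_le_of_inner_le {m : ℕ} {A B : Matrix (Fin m) (Fin m) ℝ} (hA : A.IsHermitian)
    (hB : B.IsHermitian)
    (h : ∀ x, inner ℝ (toEuclideanLin A x) x ≤ inner ℝ (toEuclideanLin B x) x) (i : Fin m) :
    hA.eigenvalues i ≤ hB.eigenvalues i :=
  LinearMap.IsSymmetric.eigenvalues_add_le _ (isSymmetric_toEuclideanLin_iff.mpr hB)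
    (isSymmetric_toEuclideanLin_iff.mpr hA) (k := 0) (G := EuclideanSpace ℝ (Fin m)) 0
    (by simp) (fun x _ => h x) _ _ rfl

/-- The total change of the singular values under a positive semidefinite perturbation. -/
theorem sum_abs_singVal_sub_le_trace {m : ℕ} {A E : Matrix (Fin m) (Fin m) ℝ}
    (hA : A.IsSymm) (hE : E.IsSymm) (hpos : ∀ x, 0 ≤ inner ℝ (toEuclideanLin E x) x) :
    ∑ i : Fin m, |singVal A i - singVal (A + E) i| ≤ E.trace := by
  have hA' := hA.isHermitian_real
  have hB' := (hA.add hE).isHermitian_real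
  obtain ⟨U, hU, eA⟩ := hA'.exists_specMat
  obtain ⟨V, hV, eB⟩ := hB'.exists_specMat
  set a := hA'.eigenvalues with ha
  set b := hB'.eigenvalues with hb
  have hab : ∀ i, a i ≤ b i := eigenvalues_le_of_inner_le hA' hB' fun x => by
    rw [map_add, LinearMap.add_apply, inner_add_left]
    linarith [hpos x]
  have htr : ∑ i, (b i - a i) = E.trace := by
    have t1 := hA'.trace_eq_sum_eigenvalues
    have t2 := hB'.trace_eq_sum_eigenvalues
    rw [trace_add] at t2
    simp only [RCLike.ofReal_real_eq_id, id_eq] at t1 t2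
    rw [Finset.sum_sub_distrib]
    linarith
  -- The matrix with spectrum `c` has singular values dominating those of both `A` and `A + E`.
  -- Comparing through it leaves only full sums of singular values, so the ordering of the
  -- eigenvalues becomes irrelevant.
  set c : Fin m → ℝ := fun i => max |a i| |b i| with hc
  have hc0 : ∀ i, |c i| = c i := fun i => abs_of_nonneg (le_max_of_le_left (abs_nonneg _))
  have sA : ∀ i : Fin m, singVal A i ≤ singVal (specMat U c) i := fun i => by
    conv_lhs => rw [eA]
    exact singVal_specMat_le hU (fun i => by rw [hc0]; exact le_max_left _ _) i
  have sB : ∀ i : Fin m, singVal (A + E) i ≤ singVal (specMat U c) i := fun i => by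
    rw [singVal_specMat_eq hU hV]
    conv_lhs => rw [eB]
    exact singVal_specMat_le hV (fun i => by rw [hc0]; exact le_max_right _ _) i
  have nA : ∑ i : Fin m, singVal A i = ∑ i, |a i| := by
    conv_lhs => rw [eA]
    exact sum_singVal_specMat hU a fun t => t
  have nB : ∑ i : Fin m, singVal (A + E) i = ∑ i, |b i| := by
    conv_lhs => rw [eB]
    exact sum_singVal_specMat hV b fun t => t
  have nC : ∑ i : Fin m, singVal (specMat U c) i = ∑ i, c i := by
    rw [sum_singVal_specMat hU c fun t => t]
    simp only [hc0]
  calc ∑ i : Fin m, |singVal A i - singVal (A + E) i|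
      ≤ ∑ i : Fin m, ((singVal (specMat U c) i - singVal A i) +
          (singVal (specMat U c) i - singVal (A + E) i)) := by
        refine Finset.sum_le_sum fun i _ => abs_le.2 ⟨?_, ?_⟩ <;> linarith [sA i, sB i]
    _ = ∑ i, ((c i - |a i|) + (c i - |b i|)) := by
        simp only [Finset.sum_add_distrib, Finset.sum_sub_distrib, nA, nB, nC]
    -- Each term equals `||a i| - |b i||`, at most `b i - a i` because `a i ≤ b i`.
    _ ≤ ∑ i, (b i - a i) := by
        refine Finset.sum_le_sum fun i _ => ?_
        have h1 := hab i
        have h2 := abs_sub_abs_le_abs_sub (a i) (b i)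
        have h3 := abs_sub_abs_le_abs_sub (b i) (a i)
        rw [abs_of_nonpos (sub_nonpos.2 h1)] at h2
        rw [abs_of_nonneg (sub_nonneg.2 h1)] at h3
        simp only [hc]
        rcases max_cases |a i| |b i| with ⟨h, _⟩ | ⟨h, _⟩ <;> rw [h] <;> linarith
    _ = E.trace := htr

/-- Concave powers of singular values under a rank-one positive semidefinite perturbation. -/
theorem sum_abs_singVal_rpow_sub_le_of_posSemidef {m : ℕ} {p : ℝ} (hp : 0 < p) (hp1 : p ≤ 1)
    {A E : Matrix (Fin m) (Fin m) ℝ} (hA : A.IsSymm) (hE : E.IsSymm)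
    (hpos : ∀ x, 0 ≤ inner ℝ (toEuclideanLin E x) x) (hrank : E.rank ≤ 1) :
    ∑ i : Fin m, |singVal A i ^ p - singVal (A + E) i ^ p| ≤ E.trace ^ p := by
  set M : ℕ → ℝ := fun i => max (singVal A i) (singVal (A + E) i)
  set l : ℕ → ℝ := fun i => min (singVal A i) (singVal (A + E) i)
  have h0 : ∀ i, 0 ≤ l i := fun i => le_min (singVal_nonneg _ _) (singVal_nonneg _ _)
  have h1 : ∀ i, l i ≤ M i := fun i => min_le_max
  -- A rank-one change shifts singular values by at most one index, which makes the intervals `[l i,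
  -- M i]` non-overlapping.
  have h2 : ∀ i, M (i + 1) ≤ l i := fun i => by
    have := singVal_add_rank_le A hrank i
    exact max_le (le_min (singVal_antitone _ (Nat.le_succ i)) this.2)
      (le_min this.1 (singVal_antitone _ (Nat.le_succ i)))
  have key := sum_rpow_sub_rpow_le_of_interlacing hp hp1 m M l h0 h1 h2
  rw [Finset.sum_range, Finset.sum_range] at key
  have e1 : ∀ i : Fin m, M i - l i = |singVal A i - singVal (A + E) i| := fun i =>
    max_sub_min_eq_abs' _ _
  have e2 : ∀ i : Fin m, M i ^ p - l i ^ p = |singVal A i ^ p - singVal (A + E) i ^ p| := by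
    intro i
    rcases le_total (singVal A i) (singVal (A + E) i) with h | h
    · have := Real.rpow_le_rpow (singVal_nonneg A i) h hp.le
      simp only [M, l, max_eq_right h, min_eq_left h]
      rw [abs_of_nonpos (sub_nonpos.2 this), neg_sub]
    · have := Real.rpow_le_rpow (singVal_nonneg (A + E) i) h hp.le
      simp only [M, l, max_eq_left h, min_eq_right h]
      rw [abs_of_nonneg (sub_nonneg.2 this)]
  simp only [e1, e2] at key
  exact key.trans (Real.rpow_le_rpow (Finset.sum_nonneg fun i _ => abs_nonneg _)
    (sum_abs_singVal_sub_le_trace hA hE hpos) hp.le)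

theorem specMat_single_rank_le {m : ℕ} (U : Matrix (Fin m) (Fin m) ℝ) (i : Fin m) (t : ℝ) :
    (specMat U (Pi.single i t)).rank ≤ 1 :=
  (rank_specMat_le U _ {i} fun j hj => by
    simpa using Pi.single_eq_of_ne (M := fun _ => ℝ) (by simpa using hj) t).trans (by simp)

theorem specMat_trace {m : ℕ} {U : Matrix (Fin m) (Fin m) ℝ} (hU : Uᵀ * U = 1) (c : Fin m → ℝ) :
    (specMat U c).trace = ∑ i, c i := by
  rw [specMat, trace_mul_comm, ← Matrix.mul_assoc, hU, Matrix.one_mul, trace_diagonal]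

theorem inner_specMat {m : ℕ} (U : Matrix (Fin m) (Fin m) ℝ) (c : Fin m → ℝ)
    (x : EuclideanSpace ℝ (Fin m)) :
    inner ℝ (toEuclideanLin (specMat U c) x) x = ∑ i, c i * (Uᵀ *ᵥ x.ofLp) i ^ 2 := by
  have e : inner ℝ (toEuclideanLin (specMat U c) x) x = x.ofLp ⬝ᵥ (specMat U c *ᵥ x.ofLp) := by
    simp [PiLp.inner_apply, dotProduct]
  rw [e, specMat, ← Matrix.mulVec_mulVec, ← Matrix.mulVec_mulVec,
    Matrix.dotProduct_mulVec, ← Matrix.mulVec_transpose]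
  simp only [dotProduct, mulVec_diagonal]
  exact Finset.sum_congr rfl fun i _ => by ring

theorem sum_abs_singVal_rpow_sub_le_single {m : ℕ} {p : ℝ} (hp : 0 < p) (hp1 : p ≤ 1)
    {A U : Matrix (Fin m) (Fin m) ℝ} (hA : A.IsSymm) (hU : Uᵀ * U = 1) (j : Fin m) (t : ℝ) :
    ∑ i : Fin m, |singVal A i ^ p - singVal (A + specMat U (Pi.single j t)) i ^ p| ≤
      |t| ^ p := by
  have main : ∀ {B : Matrix (Fin m) (Fin m) ℝ} (_ : B.IsSymm) {u : ℝ} (_ : 0 ≤ u),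
      ∑ i : Fin m, |singVal B i ^ p - singVal (B + specMat U (Pi.single j u)) i ^ p| ≤ u ^ p := by
    intro B hB u hu
    have := sum_abs_singVal_rpow_sub_le_of_posSemidef hp hp1 hB
      (specMat_isSymm U (Pi.single j u)) (fun x => ?_) (specMat_single_rank_le U j u)
    · rwa [specMat_trace hU, Finset.sum_pi_single', if_pos (Finset.mem_univ _)] at this
    · rw [inner_specMat]
      refine Finset.sum_nonneg fun i _ => mul_nonneg ?_ (sq_nonneg _)
      by_cases h : i = j
      · subst h; simpa using hu
      · simp [h]
  rcases le_total 0 t with ht | ht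
  · rw [abs_of_nonneg ht]; exact main hA ht
  · rw [abs_of_nonpos ht]
    -- For negative `t` the roles are exchanged: `A` is a positive perturbation of the perturbed
    -- matrix.
    have := main (hA.add (specMat_isSymm U (Pi.single j t))) (neg_nonneg.2 ht)
    rw [add_assoc, ← specMat_add, ← Pi.single_add, add_neg_cancel, Pi.single_zero, specMat_zero,
      add_zero] at this
    simpa only [abs_sub_comm] using this

theorem singVal_sub_comm {m : ℕ} (A B : Matrix (Fin m) (Fin m) ℝ) (i : ℕ) :
    singVal (A - B) i = singVal (B - A) i :=
  singVal_congr_of_transpose_mul (by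
    rw [← neg_sub B A, transpose_neg, _root_.neg_mul_neg]) i

/-- The perturbation inequality for concave powers of singular values of symmetric matrices. -/
theorem sum_abs_singVal_rpow_sub_le {m : ℕ} {p : ℝ} (hp : 0 < p) (hp1 : p ≤ 1)
    {A B : Matrix (Fin m) (Fin m) ℝ} (hA : A.IsSymm) (hB : B.IsSymm) :
    ∑ i : Fin m, |singVal A i ^ p - singVal B i ^ p| ≤ ∑ i : Fin m, singVal (A - B) i ^ p := by
  obtain ⟨U, c, hU, hX, hc⟩ := (hB.sub hA).exists_specMat
  -- The eigenvalues of `B - A` are added one at a time. A step costs `|c j| ^ p`, and these costs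
  -- sum exactly to the right-hand side.
  have part : ∀ s : Finset (Fin m), ∑ i : Fin m, |singVal A i ^ p -
      singVal (A + specMat U (∑ j ∈ s, Pi.single j (c j))) i ^ p| ≤ ∑ j ∈ s, |c j| ^ p := by
    intro s
    induction s using Finset.induction_on with
    | empty => simp [specMat_zero]
    | insert j s hj ih =>
      rw [Finset.sum_insert hj, Finset.sum_insert hj, add_comm (Pi.single j (c j) : Fin m → ℝ), specMat_add,
        ← add_assoc]
      have h1 := sum_abs_singVal_rpow_sub_le_single hp hp1
        (hA.add (specMat_isSymm U (∑ j ∈ s, Pi.single j (c j)))) hU j (c j)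
      refine (Finset.sum_le_sum fun (i : Fin m) _ => abs_sub_le _ (singVal (A +
        specMat U (∑ j ∈ s, Pi.single j (c j))) i ^ p) _).trans ?_
      rw [Finset.sum_add_distrib]
      exact (add_le_add ih h1).trans_eq (add_comm _ _)
  have := part Finset.univ
  rw [Finset.univ_sum_single, ← hX, add_sub_cancel] at this
  simpa only [singVal_sub_comm A B, ← hc] using this

/-! ### Scalar inequalities and blocks of sequences -/

section scalar

theorem rpow_sum_le_sum_rpow {ι : Type*} (s : Finset ι) (f : ι → ℝ) (hf : ∀ i ∈ s, 0 ≤ f i)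
    {p : ℝ} (hp : 0 < p) (hp1 : p ≤ 1) : (∑ i ∈ s, f i) ^ p ≤ ∑ i ∈ s, f i ^ p := by
  classical
  induction s using Finset.induction_on with
  | empty => simp [Real.zero_rpow hp.ne']
  | insert a s ha ih =>
    rw [Finset.sum_insert ha, Finset.sum_insert ha]
    have h1 := ih fun i hi => hf i (Finset.mem_insert_of_mem hi)
    have h2 := Real.rpow_add_le_add_rpow (hf a (Finset.mem_insert_self _ _))
      (Finset.sum_nonneg fun i hi => hf i (Finset.mem_insert_of_mem hi)) hp.le hp1
    linarith

theorem sum_rpow_le_rpow_sum {ι : Type*} (s : Finset ι) (f : ι → ℝ) (hf : ∀ i ∈ s, 0 ≤ f i)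
    {p : ℝ} (hp1 : 1 ≤ p) : ∑ i ∈ s, f i ^ p ≤ (∑ i ∈ s, f i) ^ p := by
  have hp : 0 < p := zero_lt_one.trans_le hp1
  have h := rpow_sum_le_sum_rpow s (fun i => f i ^ p) (fun i hi => Real.rpow_nonneg (hf i hi) _)
    (inv_pos.2 hp) (inv_le_one_of_one_le₀ hp1)
  have h2 : ∑ i ∈ s, (f i ^ p) ^ p⁻¹ = ∑ i ∈ s, f i :=
    Finset.sum_congr rfl fun i hi => Real.rpow_rpow_inv (hf i hi) hp.ne'
  rw [h2] at h
  exact (Real.rpow_inv_le_iff_of_pos (Finset.sum_nonneg fun i hi => Real.rpow_nonneg (hf i hi) _)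
    (Finset.sum_nonneg hf) hp).1 h

/-- The power mean inequality with exponent `2 / p`, raised to the power `p / 2`. -/
theorem sum_rpow_le_card_mul_sum_sq {ι : Type*} (s : Finset ι) (f : ι → ℝ)
    (hf : ∀ i ∈ s, 0 ≤ f i) {p : ℝ} (hp : 0 < p) (hp2 : p ≤ 2) :
    ∑ i ∈ s, f i ^ p ≤ (s.card : ℝ) ^ (1 - p / 2) * (∑ i ∈ s, f i ^ 2) ^ (p / 2) := by
  have h := Real.rpow_sum_le_const_mul_sum_rpow_of_nonneg s (f := fun i => f i ^ p)
    (p := 2 / p) ((one_le_div hp).2 hp2) fun i hi => Real.rpow_nonneg (hf i hi) _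
  have h2 : ∑ i ∈ s, (f i ^ p) ^ (2 / p) = ∑ i ∈ s, f i ^ 2 := by
    refine Finset.sum_congr rfl fun i hi => ?_
    rw [← Real.rpow_mul (hf i hi), mul_div_cancel₀ _ hp.ne', Real.rpow_two]
  rw [h2] at h
  have hS : 0 ≤ ∑ i ∈ s, f i ^ p := Finset.sum_nonneg fun i hi => Real.rpow_nonneg (hf i hi) _
  have h3 := Real.rpow_le_rpow (Real.rpow_nonneg hS _) h (show 0 ≤ p / 2 by positivity)
  rw [← Real.rpow_mul hS, Real.mul_rpow (by positivity) (Finset.sum_nonneg fun i _ => sq_nonneg _),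
    ← Real.rpow_mul (by positivity)] at h3
  have e1 : 2 / p * (p / 2) = 1 := by field_simp
  have e2 : (2 / p - 1) * (p / 2) = 1 - p / 2 := by field_simp
  rwa [e1, e2, Real.rpow_one] at h3

theorem add_rpow_le_two_rpow_mul {x y e : ℝ} (hx : 0 ≤ x) (hy : 0 ≤ y) (he : 1 ≤ e) :
    (x + y) ^ e ≤ 2 ^ (e - 1) * (x ^ e + y ^ e) := by
  have := Real.rpow_sum_le_const_mul_sum_rpow_of_nonneg (Finset.univ : Finset (Fin 2))
    (f := ![x, y]) he (by intro i _; fin_cases i <;> simpa)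
  simpa using this

theorem sum_blocks (f : ℕ → ℝ) (r s n : ℕ) :
    ∑ j ∈ Finset.range n, ∑ i ∈ Finset.Ico (r + j * s) (r + (j + 1) * s), f i =
      ∑ i ∈ Finset.Ico r (r + n * s), f i := by
  induction n with
  | zero => simp
  | succ n ih =>
    rw [Finset.sum_range_succ, ih, Finset.sum_Ico_consecutive _ (by omega)
      (Nat.add_le_add_left (Nat.mul_le_mul_right _ (Nat.le_succ n)) r)]

/-- The block estimate for a nonincreasing sequence. -/
theorem sum_blocks_sq_rpow_le {h : ℕ → ℝ} (h0 : ∀ i, 0 ≤ h i) (hh : Antitone h) {p q : ℝ}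
    (hp : 0 < p) (hpq : p ≤ q) (r : ℕ) {s : ℕ} (hs : 0 < s) (n : ℕ) :
    ∑ j ∈ Finset.range n,
        (∑ i ∈ Finset.Ico (r + (j + 1) * s) (r + (j + 1 + 1) * s), h i ^ 2) ^ (q / 2) ≤
      (s : ℝ) ^ (-((1 / p - 1 / 2) * q)) *
        (∑ i ∈ Finset.Ico r (r + n * s), h i ^ p) ^ (q / p) := by
  have hq : 0 < q := hp.trans_le hpq
  have hs' : (0 : ℝ) < s := by exact_mod_cast hs
  set w : ℕ → ℝ := fun j => ∑ i ∈ Finset.Ico (r + j * s) (r + (j + 1) * s), h i ^ p with hw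
  have hw0 : ∀ j, 0 ≤ w j := fun j => Finset.sum_nonneg fun i _ => Real.rpow_nonneg (h0 i) _
  have hcard : ∀ j, (Finset.Ico (r + j * s) (r + (j + 1) * s)).card = s := fun j => by
    rw [Nat.card_Ico, add_mul, one_mul]; omega
  have hblock : ∀ j, (∑ i ∈ Finset.Ico (r + (j + 1) * s) (r + (j + 1 + 1) * s), h i ^ 2) ^ (q / 2)
      ≤ (s : ℝ) ^ (-((1 / p - 1 / 2) * q)) * w j ^ (q / p) := by
    intro j
    -- The largest entry of block `j + 1` bounds that block from above and block `j` from below.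
    set u := h (r + (j + 1) * s)
    have hu : 0 ≤ u := h0 _
    have b1 : ∑ i ∈ Finset.Ico (r + (j + 1) * s) (r + (j + 1 + 1) * s), h i ^ 2 ≤ s * u ^ 2 := by
      have := Finset.sum_le_card_nsmul (Finset.Ico (r + (j + 1) * s) (r + (j + 1 + 1) * s))
        (fun i => h i ^ 2) (u ^ 2) fun i hi =>
          pow_le_pow_left₀ (h0 i) (hh (Finset.mem_Ico.1 hi).1) 2
      rwa [hcard, nsmul_eq_mul] at this
    have b2 : s * u ^ p ≤ w j := by
      have := Finset.card_nsmul_le_sum (Finset.Ico (r + j * s) (r + (j + 1) * s))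
        (fun i => h i ^ p) (u ^ p) fun i hi =>
          Real.rpow_le_rpow hu (hh (Finset.mem_Ico.1 hi).2.le) hp.le
      rwa [hcard, nsmul_eq_mul] at this
    calc _ ≤ (s * u ^ 2) ^ (q / 2) := Real.rpow_le_rpow
          (Finset.sum_nonneg fun i _ => sq_nonneg _) b1 (by positivity)
      _ = (s : ℝ) ^ (-((1 / p - 1 / 2) * q)) * (s * u ^ p) ^ (q / p) := by
        rw [Real.mul_rpow hs'.le (by positivity), Real.mul_rpow hs'.le (by positivity),
          ← Real.rpow_two, ← Real.rpow_mul hu, ← Real.rpow_mul hu, ← mul_assoc,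
          ← Real.rpow_add hs']
        congr 2
        · field_simp
          ring
        · field_simp
      _ ≤ _ := by
        gcongr
  calc _ ≤ ∑ j ∈ Finset.range n, (s : ℝ) ^ (-((1 / p - 1 / 2) * q)) * w j ^ (q / p) :=
        Finset.sum_le_sum fun j _ => hblock j
    _ = (s : ℝ) ^ (-((1 / p - 1 / 2) * q)) * ∑ j ∈ Finset.range n, w j ^ (q / p) := by
        rw [Finset.mul_sum]
    _ ≤ (s : ℝ) ^ (-((1 / p - 1 / 2) * q)) * (∑ j ∈ Finset.range n, w j) ^ (q / p) := by
        gcongr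
        exact sum_rpow_le_rpow_sum _ _ (fun j _ => hw0 j) ((one_le_div hp).2 hpq)
    _ = _ := by rw [hw, sum_blocks]

theorem sum_fin_ite_mem {m : ℕ} (f : ℕ → ℝ) (hf : ∀ i, m ≤ i → f i = 0) (B : Finset ℕ) :
    ∑ i : Fin m, (if (i : ℕ) ∈ B then f i else 0) = ∑ i ∈ B, f i := by
  rw [Fin.sum_univ_eq_sum_range (fun i => if i ∈ B then f i else 0) m, ← Finset.sum_filter]
  refine Finset.sum_subset (fun i hi => (Finset.mem_filter.1 hi).2) fun i hi hn => ?_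
  refine hf i (not_lt.1 fun h => hn (Finset.mem_filter.2 ⟨Finset.mem_range.2 h, hi⟩))

end scalar

/-! ### Quasi-norms of vectors and matrices -/

section norms

theorem lqNorm_rpow {N : ℕ} {q : ℝ} (hq : 0 < q) (z : Fin N → ℝ) :
    lqNorm q z ^ q = ∑ j, |z j| ^ q := by
  rw [lqNorm, one_div, Real.rpow_inv_rpow (Finset.sum_nonneg fun j _ => by positivity) hq.ne']

theorem lqNorm_nonneg {N : ℕ} (q : ℝ) (z : Fin N → ℝ) : 0 ≤ lqNorm q z :=
  Real.rpow_nonneg (Finset.sum_nonneg fun j _ => by positivity) _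

theorem lqNorm_zero_rpow {N : ℕ} {q : ℝ} (hq : 0 < q) : lqNorm q (0 : Fin N → ℝ) ^ q = 0 := by
  rw [lqNorm_rpow hq]
  simp [Real.zero_rpow hq.ne']

theorem lqNorm_neg {N : ℕ} (q : ℝ) (z : Fin N → ℝ) : lqNorm q (-z) = lqNorm q z := by
  simp [lqNorm]

theorem lqNorm_add_rpow_le {N : ℕ} {q : ℝ} (hq : 0 < q) (hq1 : q ≤ 1) (x y : Fin N → ℝ) :
    lqNorm q (x + y) ^ q ≤ lqNorm q x ^ q + lqNorm q y ^ q := by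
  simp only [lqNorm_rpow hq, ← Finset.sum_add_distrib]
  refine Finset.sum_le_sum fun j _ => ?_
  exact (Real.rpow_le_rpow (abs_nonneg _) (abs_add_le _ _) hq.le).trans
    (Real.rpow_add_le_add_rpow (abs_nonneg _) (abs_nonneg _) hq.le hq1)

theorem lqNorm_sub_rpow_le {N : ℕ} {q : ℝ} (hq : 0 < q) (hq1 : q ≤ 1) (x y : Fin N → ℝ) :
    lqNorm q (x - y) ^ q ≤ lqNorm q x ^ q + lqNorm q y ^ q := by
  rw [sub_eq_add_neg, ← lqNorm_neg q y]
  exact lqNorm_add_rpow_le hq hq1 x (-y)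

theorem lqNorm_sum_rpow_le {N : ℕ} {q : ℝ} (hq : 0 < q) (hq1 : q ≤ 1) {ι : Type*} (s : Finset ι)
    (x : ι → Fin N → ℝ) : lqNorm q (∑ i ∈ s, x i) ^ q ≤ ∑ i ∈ s, lqNorm q (x i) ^ q := by
  classical
  induction s using Finset.induction_on with
  | empty => simp [lqNorm_zero_rpow hq]
  | insert a s ha ih =>
    rw [Finset.sum_insert ha, Finset.sum_insert ha]
    exact (lqNorm_add_rpow_le hq hq1 _ _).trans (by linarith)

theorem schatten_nonneg {m : ℕ} (p : ℝ) (X : Matrix (Fin m) (Fin m) ℝ) : 0 ≤ schatten p X :=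
  Real.rpow_nonneg (Finset.sum_nonneg fun _ _ => Real.rpow_nonneg (singVal_nonneg _ _) _) _

theorem schatten_rpow {m : ℕ} {p : ℝ} (hp : 0 < p) (X : Matrix (Fin m) (Fin m) ℝ) :
    schatten p X ^ p = ∑ i : Fin m, singVal X i ^ p := by
  rw [schatten, one_div, Real.rpow_inv_rpow (Finset.sum_nonneg fun j _ =>
    Real.rpow_nonneg (singVal_nonneg _ _) _) hp.ne']

theorem schatten_two_rpow {m : ℕ} (q : ℝ) (X : Matrix (Fin m) (Fin m) ℝ) :
    schatten 2 X ^ q = (∑ i : Fin m, singVal X i ^ 2) ^ (q / 2) := by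
  simp only [schatten, Real.rpow_two]
  rw [← Real.rpow_mul (Finset.sum_nonneg fun i _ => sq_nonneg _)]
  congr 1; ring

theorem singVal_zero {m : ℕ} (i : ℕ) : singVal (0 : Matrix (Fin m) (Fin m) ℝ) i = 0 := by
  simp [singVal]

theorem schatten_zero {m : ℕ} {p : ℝ} (hp : 0 < p) :
    schatten p (0 : Matrix (Fin m) (Fin m) ℝ) = 0 := by
  simp [schatten, singVal_zero, Real.zero_rpow hp.ne', hp.ne']

theorem SymmRUB.bounds {m N : ℕ} {A : Fin N → Matrix (Fin m) (Fin m) ℝ} {q : ℝ} {r : ℕ}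
    {C₁ C₂ : ℝ} (hA : SymmRUB A q r C₁ C₂) (hq : 0 < q) {X : Matrix (Fin m) (Fin m) ℝ}
    (hX : X.IsSymm) (hr : X.rank ≤ r) :
    C₁ * schatten 2 X ^ q ≤ lqNorm q (measOp A X) ^ q / N ∧
      lqNorm q (measOp A X) ^ q / N ≤ C₂ * schatten 2 X ^ q := by
  by_cases h : X = 0
  · subst h
    rw [map_zero, lqNorm_zero_rpow hq, schatten_zero two_pos, Real.zero_rpow hq.ne']
    simp
  · exact hA X hX h hr

end norms

/-! ### Block decomposition of the error -/

/-- Restricting the spectral data to a set of indices. -/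
def restrictSpec {m : ℕ} (U : Matrix (Fin m) (Fin m) ℝ) (c : Fin m → ℝ) (B : Finset ℕ) :
    Matrix (Fin m) (Fin m) ℝ :=
  specMat U fun i => if (i : ℕ) ∈ B then c i else 0

theorem rank_restrictSpec_le {m : ℕ} (U : Matrix (Fin m) (Fin m) ℝ) (c : Fin m → ℝ)
    (B : Finset ℕ) : (restrictSpec U c B).rank ≤ B.card := by
  refine (rank_specMat_le U _ (Finset.univ.filter fun i : Fin m => (i : ℕ) ∈ B) fun i hi =>
    if_neg fun h => hi (by simpa using h)).trans ?_
  exact Finset.card_le_card_of_injOn Fin.val (fun i hi => (Finset.mem_filter.1 hi).2)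
    Fin.val_injective.injOn

theorem schatten_two_restrictSpec {m : ℕ} {U : Matrix (Fin m) (Fin m) ℝ} (hU : Uᵀ * U = 1)
    {c : Fin m → ℝ} {h : ℕ → ℝ} (hc : ∀ i : Fin m, |c i| = h i) (h0 : ∀ i, m ≤ i → h i = 0)
    (q : ℝ) (B : Finset ℕ) :
    schatten 2 (restrictSpec U c B) ^ q = (∑ i ∈ B, h i ^ 2) ^ (q / 2) := by
  rw [schatten_two_rpow, restrictSpec, sum_singVal_specMat hU _ fun t => t ^ 2,
    ← sum_fin_ite_mem (fun i => h i ^ 2) (fun i hi => by simp [h0 i hi]) B]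
  congr 1
  refine Finset.sum_congr rfl fun i _ => ?_
  split_ifs <;> simp [← hc]

theorem restrictSpec_add_sum {m : ℕ} (U : Matrix (Fin m) (Fin m) ℝ) (c : Fin m → ℝ) (r s : ℕ)
    (hs : 0 < s) :
    restrictSpec U c (Finset.range (r + s)) + ∑ j ∈ Finset.range m,
      restrictSpec U c (Finset.Ico (r + (j + 1) * s) (r + (j + 1 + 1) * s)) = specMat U c := by
  simp only [restrictSpec]
  rw [← specMat_sum, ← specMat_add]
  congr 1
  funext i
  rw [Pi.add_apply, Finset.sum_apply]
  -- With a point mass at `i`, the identity says that consecutive intervals partition a range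
  -- containing `i`; as `s ≥ 1`, `m` blocks reach far enough.
  set f : ℕ → ℝ := fun l => if l = i then c i else 0 with hf
  have e : ∀ B : Finset ℕ, (if (i : ℕ) ∈ B then c i else 0) = ∑ l ∈ B, f l := fun B => by
    rw [hf, Finset.sum_ite_eq']
  simp only [e]
  have := sum_blocks f (r + s) s m
  have e2 : ∀ j, Finset.Ico (r + (j + 1) * s) (r + (j + 1 + 1) * s) =
      Finset.Ico (r + s + j * s) (r + s + (j + 1) * s) := fun j => by
    congr 1 <;> ring
  simp only [e2]
  rw [this, Finset.range_eq_Ico, Finset.sum_Ico_consecutive _ (Nat.zero_le _) (by omega), ← e,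
    if_pos]
  have h1 := i.2
  have h2 : m * 1 ≤ m * s := Nat.mul_le_mul_left m hs
  simp only [Finset.mem_Ico]
  omega

/-- Consequences of restricted uniform boundedness for the block decomposition of a symmetric
matrix. -/
theorem SymmRUB.block_bounds {m N : ℕ} {A : Fin N → Matrix (Fin m) (Fin m) ℝ} {p q : ℝ}
    {r s : ℕ} {C₁ C₂ : ℝ} (hA : SymmRUB A q (s + r) C₁ C₂) (hp : 0 < p) (hpq : p ≤ q)
    (hq1 : q ≤ 1) (hs : 0 < s) {H : Matrix (Fin m) (Fin m) ℝ} (hH : H.IsSymm) :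
    ∃ Q : ℝ, Q ≤ (s : ℝ) ^ (-((1 / p - 1 / 2) * q)) *
        (∑ i ∈ Finset.Ico r (r + m * s), singVal H i ^ p) ^ (q / p) ∧
      C₁ * (∑ i ∈ Finset.range (r + s), singVal H i ^ 2) ^ (q / 2) ≤
        lqNorm q (measOp A H) ^ q / N + C₂ * Q ∧
      schatten 2 H ^ q ≤ (∑ i ∈ Finset.range (r + s), singVal H i ^ 2) ^ (q / 2) + Q := by
  have hq : 0 < q := hp.trans_le hpq
  obtain ⟨U, c, hU, hHU, hc⟩ := hH.exists_specMat
  have h0 : ∀ i, m ≤ i → singVal H i = 0 := fun i hi => singVal_of_le H hi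
  set B : ℕ → Finset ℕ := fun j => Finset.Ico (r + (j + 1) * s) (r + (j + 1 + 1) * s) with hB
  have hBc : ∀ j, (B j).card = s := fun j => by
    rw [hB, Nat.card_Ico, add_mul (j + 1), one_mul]; omega
  have hsplit := restrictSpec_add_sum U c r s hs
  rw [← hHU] at hsplit
  have hn : ∀ D, schatten 2 (restrictSpec U c D) ^ q =
      (∑ i ∈ D, singVal H i ^ 2) ^ (q / 2) := schatten_two_restrictSpec hU hc h0 q
  refine ⟨∑ j ∈ Finset.range m, (∑ i ∈ B j, singVal H i ^ 2) ^ (q / 2),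
    sum_blocks_sq_rpow_le (singVal_nonneg H) (singVal_antitone H) hp hpq r hs m, ?_, ?_⟩
  · have h1 := (hA.bounds hq (specMat_isSymm U _) ((rank_restrictSpec_le U c
      (Finset.range (r + s))).trans (by rw [Finset.card_range, add_comm]))).1
    have hj : ∀ j, lqNorm q (measOp A (restrictSpec U c (B j))) ^ q / N ≤
        C₂ * (∑ i ∈ B j, singVal H i ^ 2) ^ (q / 2) := fun j => by
      rw [← hn]
      exact (hA.bounds hq (specMat_isSymm U _) ((rank_restrictSpec_le U c (B j)).trans
        (by rw [hBc]; omega))).2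
    change C₁ * schatten 2 (restrictSpec U c (Finset.range (r + s))) ^ q ≤
      lqNorm q (measOp A (restrictSpec U c (Finset.range (r + s)))) ^ q / N at h1
    rw [hn] at h1
    refine h1.trans ?_
    have h2 : restrictSpec U c (Finset.range (r + s)) =
        H - ∑ j ∈ Finset.range m, restrictSpec U c (B j) := eq_sub_of_add_eq hsplit
    rw [h2, map_sub, map_sum]
    have h3 := (lqNorm_sub_rpow_le hq hq1 (measOp A H)
      (∑ j ∈ Finset.range m, measOp A (restrictSpec U c (B j)))).trans
        (add_le_add_right (lqNorm_sum_rpow_le hq hq1 _ _) _)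
    have h4 := div_le_div_of_nonneg_right h3 (Nat.cast_nonneg (α := ℝ) N)
    refine h4.trans ?_
    rw [add_div, Finset.sum_div, Finset.mul_sum]
    exact add_le_add_right (Finset.sum_le_sum fun j _ => hj j) _
  · have h1 : ∑ i : Fin m, singVal H i ^ 2 = ∑ i ∈ Finset.range (r + s), singVal H i ^ 2 +
        ∑ j ∈ Finset.range m, ∑ i ∈ B j, singVal H i ^ 2 := by
      have h2 := sum_fin_ite_mem (m := m) (fun i => singVal H i ^ 2)
        (fun i hi => by simp [h0 i hi])
      -- One block more than in the decomposition: block `0` is `[r, r + s)`, which belongs to the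
      -- head.
      have h3 := sum_blocks (fun i => singVal H i ^ 2) r s (m + 1)
      rw [Finset.sum_range_succ', zero_mul, zero_add, one_mul, add_zero] at h3
      have h4 := h2 (Finset.range (r + (m + 1) * s))
      have h5 : ∀ i : Fin m, (i : ℕ) ∈ Finset.range (r + (m + 1) * s) := fun i => by
        have h1 := i.2
        have h2 : (m + 1) * 1 ≤ (m + 1) * s := Nat.mul_le_mul_left _ hs
        simp only [Finset.mem_range]; omega
      simp only [h5, if_true] at h4
      rw [h4, Finset.range_eq_Ico, Finset.range_eq_Ico,
        ← Finset.sum_Ico_consecutive _ (Nat.zero_le r) (Nat.le_add_right r _), ← h3,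
        ← Finset.sum_Ico_consecutive _ (Nat.zero_le r) (Nat.le_add_right r s)]
      simp only [hB]
      ring
    have hsq : ∀ D : Finset ℕ, 0 ≤ ∑ i ∈ D, singVal H i ^ 2 := fun D =>
      Finset.sum_nonneg fun i _ => sq_nonneg _
    rw [schatten_two_rpow, h1]
    refine (Real.rpow_add_le_add_rpow (hsq _) (Finset.sum_nonneg fun j _ => hsq _)
      (by positivity) (by linarith)).trans ?_
    exact add_le_add_right (rpow_sum_le_sum_rpow _ _ (fun j _ => hsq _) (by positivity)
      (by linarith)) _

/-! ### Cone condition, duality and the basic error estimates -/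

theorem sum_fin_eq_sum_range_of_le {m n : ℕ} (f : ℕ → ℝ) (hf : ∀ i, m ≤ i → f i = 0)
    (hn : m ≤ n) : ∑ i : Fin m, f i = ∑ i ∈ Finset.range n, f i := by
  rw [Fin.sum_univ_eq_sum_range f m]
  exact Finset.sum_subset (Finset.range_mono hn) fun i _ hi => hf i (by simpa using hi)

/-- The cone condition satisfied by the error of a Schatten-`p` minimizer. -/
theorem sum_tail_singVal_rpow_le {m r n : ℕ} {p : ℝ} (hp : 0 < p) (hp1 : p ≤ 1)
    {X Y Z : Matrix (Fin m) (Fin m) ℝ} (hX : X.IsSymm) (hY : Y.IsSymm)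
    (hmin : schatten p Y ^ p ≤ schatten p X ^ p) (hZ : Z.rank ≤ r) (hn : m ≤ n) :
    ∑ i ∈ Finset.Ico r (r + n), singVal (Y - X) i ^ p ≤
      ∑ i ∈ Finset.range r, singVal (Y - X) i ^ p + 2 * schatten p (X - Z) ^ p := by
  have hz : ∀ (W : Matrix (Fin m) (Fin m) ℝ) i, m ≤ i → singVal W i ^ p = 0 := fun W i hi => by
    rw [singVal_of_le W hi, Real.zero_rpow hp.ne']
  rw [schatten_rpow hp, schatten_rpow hp] at hmin
  rw [schatten_rpow hp]
  -- Applied to `X` and `X - Y`, whose difference is `Y`; minimality then replaces `Y` by `X` on the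
  -- right. Opening the absolute values with opposite signs before and after index `r` leaves twice
  -- the tail of `X`.
  have h1 := sum_abs_singVal_rpow_sub_le hp hp1 hX (hX.sub hY)
  rw [sub_sub_cancel] at h1
  simp only [singVal_sub_comm X Y] at h1
  have h2 := h1.trans hmin
  rw [sum_fin_eq_sum_range_of_le (n := r + n) (fun i => singVal X i ^ p) (hz X) (by omega),
    sum_fin_eq_sum_range_of_le (n := r + n)
      (fun i => |singVal X i ^ p - singVal (Y - X) i ^ p|)
      (fun i hi => by simp [hz _ i hi]) (by omega),
    Finset.range_eq_Ico, ← Finset.sum_Ico_consecutive _ (Nat.zero_le r) (Nat.le_add_right r n),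
    ← Finset.sum_Ico_consecutive _ (Nat.zero_le r) (Nat.le_add_right r n)] at h2
  rw [Finset.range_eq_Ico]
  have h3 : ∑ i ∈ Finset.Ico 0 r, (singVal X i ^ p - singVal (Y - X) i ^ p) ≤
      ∑ i ∈ Finset.Ico 0 r, |singVal X i ^ p - singVal (Y - X) i ^ p| :=
    Finset.sum_le_sum fun i _ => le_abs_self _
  have h4 : ∑ i ∈ Finset.Ico r (r + n), (singVal (Y - X) i ^ p - singVal X i ^ p) ≤
      ∑ i ∈ Finset.Ico r (r + n), |singVal X i ^ p - singVal (Y - X) i ^ p| :=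
    Finset.sum_le_sum fun i _ => by rw [abs_sub_comm]; exact le_abs_self _
  rw [Finset.sum_sub_distrib] at h3 h4
  -- Removing `Z`, of rank at most `r`, shifts indices by at most `r`.
  have h5 : ∑ i ∈ Finset.Ico r (r + n), singVal X i ^ p ≤
      ∑ i : Fin m, singVal (X - Z) i ^ p := by
    rw [sum_fin_eq_sum_range_of_le (fun i => singVal (X - Z) i ^ p) (hz (X - Z)) hn,
      Finset.sum_Ico_eq_sum_range, Nat.add_sub_cancel_left]
    refine Finset.sum_le_sum fun i _ => ?_
    have := (singVal_add_rank_le (X - Z) hZ i).1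
    rw [sub_add_cancel, add_comm] at this
    exact Real.rpow_le_rpow (singVal_nonneg _ _) this hp.le
  linarith

/-- In an eigenbasis of `H` the trace is the sum of the eigenvalues weighted by the diagonal entries
of `Zᵀ`, each at most the operator norm. -/
theorem abs_trace_transpose_mul_le {m : ℕ} (Z : Matrix (Fin m) (Fin m) ℝ)
    {H : Matrix (Fin m) (Fin m) ℝ} (hH : H.IsSymm) :
    |(Zᵀ * H).trace| ≤ schattenInf Z * ∑ i : Fin m, singVal H i := by
  obtain ⟨U, c, hU, hHU, hc⟩ := hH.exists_specMat
  have e : (Zᵀ * H).trace = ∑ i, (Uᵀ * Zᵀ * U) i i * c i := by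
    rw [hHU, specMat, ← Matrix.mul_assoc, ← Matrix.mul_assoc, trace_mul_comm,
      ← Matrix.mul_assoc, ← Matrix.mul_assoc, trace]
    simp [mul_diagonal]
  have hd : ∀ i, |(Uᵀ * Zᵀ * U) i i| ≤ schattenInf Z := by
    intro i
    set u : EuclideanSpace ℝ (Fin m) := WithLp.toLp 2 (fun k => U k i) with hu
    have hu1 : ‖u‖ = 1 := by
      have h1 : ‖u‖ ^ 2 = (Uᵀ * U) i i := by
        rw [EuclideanSpace.norm_sq_eq, Matrix.mul_apply]
        simp [hu, sq]
      rw [hU, one_apply_eq] at h1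
      exact (sq_eq_sq₀ (norm_nonneg _) zero_le_one).1 (by rw [h1, one_pow])
    have h2 : (Uᵀ * Zᵀ * U) i i = inner ℝ (toEuclideanCLM (n := Fin m) (𝕜 := ℝ) Z u) u := by
      rw [← transpose_mul, Matrix.mul_apply]
      simp [hu, PiLp.inner_apply, Matrix.mul_apply, mulVec, dotProduct, mul_comm]
    rw [h2]
    refine (abs_real_inner_le_norm _ _).trans ?_
    have := (toEuclideanCLM (n := Fin m) (𝕜 := ℝ) Z).le_opNorm u
    rw [hu1, mul_one] at this ⊢
    exact this
  rw [e, Finset.mul_sum]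
  refine (Finset.abs_sum_le_sum_abs _ _).trans (Finset.sum_le_sum fun i _ => ?_)
  rw [abs_mul, hc]
  exact mul_le_mul_of_nonneg_right (hd i) (singVal_nonneg _ _)

theorem schattenInf_sub_le {m : ℕ} (X Y : Matrix (Fin m) (Fin m) ℝ) :
    schattenInf (X - Y) ≤ schattenInf X + schattenInf Y := by
  rw [schattenInf, map_sub]
  exact norm_sub_le _ _

theorem schattenInf_nonneg {m : ℕ} (X : Matrix (Fin m) (Fin m) ℝ) : 0 ≤ schattenInf X :=
  norm_nonneg _

theorem measOpAdj_sub {m N : ℕ} (A : Fin N → Matrix (Fin m) (Fin m) ℝ) (z w : Fin N → ℝ) :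
    measOpAdj A (z - w) = measOpAdj A z - measOpAdj A w := by
  simp [measOpAdj, sub_smul, Finset.sum_sub_distrib]

/-- Hölder passes from `ℓ_q` to `ℓ_2`; the squared `ℓ_2` norm of the measurements is the pairing of
`H` with the adjoint applied to them, bounded by duality. -/
theorem lqNorm_measOp_rpow_le {m N : ℕ} (A : Fin N → Matrix (Fin m) (Fin m) ℝ) {q : ℝ}
    (hq : 0 < q) (hq1 : q ≤ 1) {H : Matrix (Fin m) (Fin m) ℝ} (hH : H.IsSymm) {η : ℝ}
    (hη : schattenInf (measOpAdj A (measOp A H)) ≤ η) :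
    lqNorm q (measOp A H) ^ q ≤
      (N : ℝ) ^ (1 - q / 2) * (η * ∑ i : Fin m, singVal H i) ^ (q / 2) := by
  rw [lqNorm_rpow hq]
  have h1 := sum_rpow_le_card_mul_sum_sq Finset.univ (fun j => |measOp A H j|)
    (fun j _ => abs_nonneg _) hq (by linarith)
  refine h1.trans ?_
  rw [Finset.card_univ, Fintype.card_fin]
  have h2 : ∑ j, |measOp A H j| ^ 2 ≤ η * ∑ i : Fin m, singVal H i := by
    have e := measOpAdj_spec A H (measOp A H)
    simp only [sq_abs]
    simp only [sq]
    rw [e]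
    refine (le_abs_self _).trans ((abs_trace_transpose_mul_le _ hH).trans ?_)
    exact mul_le_mul_of_nonneg_right hη (Finset.sum_nonneg fun i _ => singVal_nonneg _ _)
  exact mul_le_mul_of_nonneg_left (Real.rpow_le_rpow (Finset.sum_nonneg fun j _ => sq_nonneg _)
    h2 (by positivity)) (by positivity)

/-- The estimates on which all recovery guarantees rest: `t` is the `q`-th power of the Frobenius
norm of the leading part of the error `Y - X`, and `P` the `p`-th power of the Schatten-`p` norm
of its first `r` components. -/
theorem SymmRUB.error_bounds {m N : ℕ} {A : Fin N → Matrix (Fin m) (Fin m) ℝ} {p q : ℝ}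
    {r s : ℕ} {C₁ C₂ : ℝ} (hA : SymmRUB A q (s + r) C₁ C₂) (hp : 0 < p) (hpq : p ≤ q)
    (hq1 : q ≤ 1) (hr : 0 < r) (hs : 0 < s) (hC₂ : 0 ≤ C₂) {X Y Z : Matrix (Fin m) (Fin m) ℝ}
    (hX : X.IsSymm) (hY : Y.IsSymm) (hmin : schatten p Y ^ p ≤ schatten p X ^ p)
    (hZ : Z.rank ≤ r) :
    ∃ t P : ℝ, 0 ≤ t ∧ 0 ≤ P ∧ P ^ (q / p) ≤ (r : ℝ) ^ ((1 / p - 1 / 2) * q) * t ∧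
      schatten 2 (Y - X) ^ q ≤ t + (s : ℝ) ^ (-((1 / p - 1 / 2) * q)) *
        (P + 2 * schatten p (X - Z) ^ p) ^ (q / p) ∧
      C₁ * t ≤ lqNorm q (measOp A (Y - X)) ^ q / N + C₂ *
        ((s : ℝ) ^ (-((1 / p - 1 / 2) * q)) * (P + 2 * schatten p (X - Z) ^ p) ^ (q / p)) ∧
      ∑ i : Fin m, singVal (Y - X) i ≤ (2 * (P + schatten p (X - Z) ^ p)) ^ (1 / p) := by
  have hq : 0 < q := hp.trans_le hpq
  have hp1 := hpq.trans hq1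
  set H := Y - X
  obtain ⟨Q, hQ, h1, h2⟩ := hA.block_bounds hp hpq hq1 hs (hY.sub hX)
  have hms : m ≤ m * s := Nat.le_mul_of_pos_right m hs
  have hcone := sum_tail_singVal_rpow_le hp hp1 hX hY hmin hZ hms
  have hσ : ∀ i, 0 ≤ singVal H i ^ p := fun i => Real.rpow_nonneg (singVal_nonneg _ _) _
  have hτ : 0 ≤ ∑ i ∈ Finset.Ico r (r + m * s), singVal H i ^ p :=
    Finset.sum_nonneg fun i _ => hσ i
  have hP : 0 ≤ ∑ i ∈ Finset.range r, singVal H i ^ p := Finset.sum_nonneg fun i _ => hσ i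
  have hQ' : Q ≤ (s : ℝ) ^ (-((1 / p - 1 / 2) * q)) *
      (∑ i ∈ Finset.range r, singVal H i ^ p + 2 * schatten p (X - Z) ^ p) ^ (q / p) := by
    refine hQ.trans (mul_le_mul_of_nonneg_left (Real.rpow_le_rpow hτ hcone ?_) ?_) <;> positivity
  refine ⟨(∑ i ∈ Finset.range (r + s), singVal H i ^ 2) ^ (q / 2),
    ∑ i ∈ Finset.range r, singVal H i ^ p,
    Real.rpow_nonneg (Finset.sum_nonneg fun i _ => sq_nonneg _) _, hP, ?_, ?_, ?_, ?_⟩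
  · have h3 := sum_rpow_le_card_mul_sum_sq (Finset.range r) (fun i => singVal H i)
      (fun i _ => singVal_nonneg _ _) hp (by linarith)
    rw [Finset.card_range] at h3
    have hr' : (0 : ℝ) < r := by exact_mod_cast hr
    have hsq : 0 ≤ ∑ i ∈ Finset.range r, singVal H i ^ 2 :=
      Finset.sum_nonneg fun i _ => sq_nonneg _
    have h4 := Real.rpow_le_rpow hP h3 (show 0 ≤ q / p by positivity)
    rw [Real.mul_rpow (by positivity) (by positivity), ← Real.rpow_mul hr'.le,
      ← Real.rpow_mul hsq] at h4
    have e1 : (1 - p / 2) * (q / p) = (1 / p - 1 / 2) * q := by field_simp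
    have e2 : p / 2 * (q / p) = q / 2 := by field_simp
    rw [e1, e2] at h4
    refine h4.trans (mul_le_mul_of_nonneg_left (Real.rpow_le_rpow hsq ?_ (by positivity))
      (by positivity))
    exact Finset.sum_le_sum_of_subset_of_nonneg (Finset.range_mono (Nat.le_add_right r s))
      fun i _ _ => sq_nonneg _
  · exact h2.trans (add_le_add_right hQ' _)
  · exact h1.trans (add_le_add_right (mul_le_mul_of_nonneg_left hQ' hC₂) _)
  -- The trace norm is at most the Schatten-`p` quasi-norm, and the cone condition bounds head plus
  -- tail by `2P` plus twice the approximation term.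
  · have h3 := sum_rpow_le_rpow_sum Finset.univ (fun i : Fin m => singVal H i ^ p)
      (fun i _ => hσ i) (p := 1 / p) ((one_le_div hp).2 hp1)
    simp only [one_div, Real.rpow_rpow_inv (singVal_nonneg H _) hp.ne'] at h3
    rw [one_div]
    refine h3.trans (Real.rpow_le_rpow (Finset.sum_nonneg fun i _ => hσ i) ?_ (by positivity))
    rw [sum_fin_eq_sum_range_of_le (n := r + m * s) (fun i => singVal H i ^ p)
      (fun i hi => by rw [singVal_of_le H hi, Real.zero_rpow hp.ne']) (by omega),
      Finset.range_eq_Ico, ← Finset.sum_Ico_consecutive _ (Nat.zero_le r)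
        (Nat.le_add_right r _), ← Finset.range_eq_Ico]
    linarith

theorem eq_zero_of_schatten_two_rpow_le_zero {m : ℕ} {q : ℝ} (hq : 0 < q)
    {H : Matrix (Fin m) (Fin m) ℝ} (hH : H.IsSymm) (h : schatten 2 H ^ q ≤ 0) : H = 0 := by
  have hsum : 0 ≤ ∑ i : Fin m, singVal H i ^ 2 := Finset.sum_nonneg fun i _ => sq_nonneg _
  rw [schatten_two_rpow] at h
  have h0 := (Real.rpow_eq_zero hsum (by positivity)).1
    (le_antisymm h (Real.rpow_nonneg hsum _))
  rw [Finset.sum_eq_zero_iff_of_nonneg fun i _ => sq_nonneg _] at h0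
  obtain ⟨U, c, -, hHU, hc⟩ := hH.exists_specMat
  have : c = 0 := funext fun i => by
    have := pow_eq_zero_iff (two_ne_zero) |>.1 (h0 i (Finset.mem_univ i))
    simpa [this] using hc i
  rw [hHU, this, specMat_zero]

/-- Restricted uniform boundedness on a nontrivial space forces `C₂ ≥ 0` and the presence of at
least one measurement. -/
theorem SymmRUB.nonneg_and_pos {m N : ℕ} {A : Fin N → Matrix (Fin m) (Fin m) ℝ} {q : ℝ} {r : ℕ}
    {C₁ C₂ : ℝ} (hA : SymmRUB A q r C₁ C₂) (hm : 0 < m) (hr : 0 < r) (hC₁ : 0 < C₁) :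
    0 ≤ C₂ ∧ 0 < N := by
  have hU : (1 : Matrix (Fin m) (Fin m) ℝ)ᵀ * 1 = 1 := by simp
  -- A rank-one test matrix of Frobenius norm one turns RUB into `C₁ ≤ C₂`, and with `N = 0` into
  -- `C₁ ≤ 0`, since division by zero gives zero.
  set c : Fin m → ℝ := Pi.single ⟨0, hm⟩ 1
  set X := specMat 1 c
  have h1 : schatten 2 X ^ q = 1 := by
    have : ∑ i, |c i| ^ 2 = 1 := by
      simp [c, Pi.single_apply]
    rw [schatten_two_rpow, sum_singVal_specMat hU c fun t => t ^ 2, this, Real.one_rpow]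
  have hX : X ≠ 0 := by
    intro h
    have := specMat_trace hU c
    rw [show specMat 1 c = 0 from h] at this
    simp [c] at this
  obtain ⟨h2, h3⟩ := hA X (specMat_isSymm _ _) hX ((specMat_single_rank_le _ _ _).trans hr)
  rw [h1, mul_one] at h2 h3
  refine ⟨by linarith, Nat.pos_of_ne_zero fun h => ?_⟩
  subst h
  simp at h2
  linarith

/-! ### Noise bounds -/

theorem lqNorm_measOp_sub_div_le {m N : ℕ} {A : Fin N → Matrix (Fin m) (Fin m) ℝ} {q η : ℝ}
    (hq : 0 < q) (hq1 : q ≤ 1) (hN : 0 < N) {b : Fin N → ℝ} {X Y : Matrix (Fin m) (Fin m) ℝ}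
    (hX : b - measOp A X ∈ lqBall N q η) (hY : b - measOp A Y ∈ lqBall N q η) :
    lqNorm q (measOp A (Y - X)) ^ q / N ≤ 1 / (N : ℝ) ^ q * (2 / (N : ℝ) ^ (1 - 2 * q) * η ^ q) := by
  have hN' : (0 : ℝ) < N := by exact_mod_cast hN
  have hb : ∀ z ∈ lqBall N q η, lqNorm q z ^ q ≤ η ^ q * (N : ℝ) ^ q := by
    intro z hz
    have h1 : lqNorm q z / N ≤ η := hz
    have h0 : 0 ≤ η := (div_nonneg (lqNorm_nonneg q z) hN'.le).trans h1
    rw [← Real.mul_rpow h0 hN'.le]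
    exact Real.rpow_le_rpow (lqNorm_nonneg q z) ((div_le_iff₀ hN').1 h1) hq.le
  have e : measOp A (Y - X) = (b - measOp A X) - (b - measOp A Y) := by
    rw [map_sub]; abel
  rw [e, div_le_iff₀ hN']
  refine (lqNorm_sub_rpow_le hq hq1 _ _).trans ?_
  have e2 : (N : ℝ) ^ (1 - 2 * q) * ((N : ℝ) ^ q * (N : ℝ) ^ q) = N := by
    rw [← Real.rpow_add hN', ← Real.rpow_add hN']
    ring_nf
    exact Real.rpow_one _
  have e3 : 1 / (N : ℝ) ^ q * (2 / (N : ℝ) ^ (1 - 2 * q) * η ^ q) * N = 2 * (η ^ q * (N : ℝ) ^ q) := by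
    have h1 := Real.rpow_pos_of_pos hN' q
    have h2 := Real.rpow_pos_of_pos hN' (1 - 2 * q)
    generalize (N : ℝ) ^ q = u at *
    generalize (N : ℝ) ^ (1 - 2 * q) = v at *
    rw [← e2]
    field_simp
  rw [e3]
  linarith [hb _ hX, hb _ hY]

/-- Both residuals satisfy the Dantzig constraint, so it holds for their difference with `2 * η`.
Squaring clears the exponent `q / 2`, and the powers of `N` combine to `N ^ (-q)`. -/
theorem sq_lqNorm_measOp_sub_div_le {m N : ℕ} {A : Fin N → Matrix (Fin m) (Fin m) ℝ} {p q η : ℝ}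
    (hq : 0 < q) (hq1 : q ≤ 1) (hN : 0 < N) {b : Fin N → ℝ} {X Y : Matrix (Fin m) (Fin m) ℝ}
    (hXs : X.IsSymm) (hYs : Y.IsSymm)
    (hX : b - measOp A X ∈ dantzigBall A η) (hY : b - measOp A Y ∈ dantzigBall A η) {S : ℝ}
    (hS0 : 0 ≤ S) (hS : ∑ i : Fin m, singVal (Y - X) i ≤ S ^ (1 / p)) :
    (lqNorm q (measOp A (Y - X)) ^ q / N) ^ 2 ≤
      1 / (N : ℝ) ^ q * (2 ^ q * η ^ q * S ^ (q / p)) := by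
  have hN' : (0 : ℝ) < N := by exact_mod_cast hN
  have hX' : schattenInf (measOpAdj A (b - measOp A X)) ≤ η := hX
  have hY' : schattenInf (measOpAdj A (b - measOp A Y)) ≤ η := hY
  have hη : 0 ≤ η := (schattenInf_nonneg _).trans hX'
  have e : measOp A (Y - X) = (b - measOp A X) - (b - measOp A Y) := by
    rw [map_sub]; abel
  have h1 : schattenInf (measOpAdj A (measOp A (Y - X))) ≤ 2 * η := by
    rw [e, measOpAdj_sub]
    exact (schattenInf_sub_le _ _).trans (by linarith)
  have hsum : 0 ≤ ∑ i : Fin m, singVal (Y - X) i := Finset.sum_nonneg fun i _ => singVal_nonneg _ _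
  have h2 := lqNorm_measOp_rpow_le A hq hq1 (hYs.sub hXs) h1
  have h3 : (2 * η * ∑ i : Fin m, singVal (Y - X) i) ^ (q / 2) ≤
      (2 * η * S ^ (1 / p)) ^ (q / 2) :=
    Real.rpow_le_rpow (by positivity) (mul_le_mul_of_nonneg_left hS (by positivity)) (by positivity)
  have h4 := h2.trans (mul_le_mul_of_nonneg_left h3 (by positivity))
  have h5 := pow_le_pow_left₀ (by positivity [lqNorm_nonneg q (measOp A (Y - X))])
    (div_le_div_of_nonneg_right h4 hN'.le) 2
  refine h5.trans (le_of_eq ?_)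
  have hSp : 0 ≤ S ^ (1 / p) := Real.rpow_nonneg hS0 _
  have hz : 0 ≤ 2 * η * S ^ (1 / p) := by positivity
  rw [div_pow, mul_pow, ← Real.rpow_mul_natCast hz, Nat.cast_two, div_mul_cancel₀ _ two_ne_zero,
    Real.mul_rpow (by positivity) hSp, Real.mul_rpow zero_le_two hη, ← Real.rpow_mul hS0,
    ← Real.rpow_mul_natCast hN'.le, ← Real.rpow_natCast (N : ℝ) 2, mul_div_right_comm,
    ← Real.rpow_sub hN']
  congr 1
  · rw [one_div, ← Real.rpow_neg hN'.le]
    congr 1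
    push_cast
    ring
  · congr 2
    ring

/-! ### Solving the inequalities for the error -/

section algebra

variable {C₁ C₂ ρ a g g' t w d y n D : ℝ}

theorem le_of_sq_le_mul_self (hρ : 0 < ρ) (ht : 0 ≤ t) (h : ρ * t ≤ w) (hw : w ^ 2 ≤ D * t)
    (hD : 0 ≤ D) : t ≤ D / ρ ^ 2 := by
  rw [le_div_iff₀ (by positivity)]
  rcases ht.eq_or_lt with h0 | h0
  · rw [← h0]; simpa using hD
  · have h1 : (ρ * t) ^ 2 ≤ w ^ 2 := pow_le_pow_left₀ (by positivity) h 2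
    refine le_of_mul_le_mul_right ?_ h0
    nlinarith

/-- Here `t` is the head of the error, `w` the measurement term, `n` its noise bound and `y` the
approximation error. Solve `h1` for `t` and insert it in `h2`; the factor `1 + g'` in front of `y`
is relaxed to `1 + g`. -/
theorem general_lq_bound (hρ : 0 < ρ) (hρe : ρ = C₁ - C₂ * g') (hC₂ : 0 ≤ C₂) (hg' : 0 ≤ g')
    (hg : g' ≤ g) (hy : 0 ≤ y) (h1 : C₁ * t ≤ w + C₂ * (g' * t + g * y))
    (h2 : d ≤ t + (g' * t + g * y)) (hw : w ≤ n) :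
    d ≤ (C₂ * g / ρ + 1) * (g + 1) * y + (g' + 1) * (1 / ρ * n) := by
  have h3 : t ≤ (n + C₂ * g * y) / ρ := by
    rw [le_div_iff₀ hρ, hρe]; linarith
  have h4 : d ≤ (1 + g') * ((n + C₂ * g * y) / ρ) + g * y := by
    have := mul_le_mul_of_nonneg_left h3 (show 0 ≤ 1 + g' by linarith)
    linarith
  have h5 : (1 + g') * (C₂ * g / ρ * y) ≤ (1 + g) * (C₂ * g / ρ * y) :=
    mul_le_mul_of_nonneg_right (by linarith) (by have := hg'.trans hg; positivity)
  have e : (n + C₂ * g * y) / ρ = 1 / ρ * n + C₂ * g / ρ * y := by ring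
  rw [e] at h4
  linarith

theorem general_dantzig_bound (hρ : 0 < ρ) (hρe : ρ = C₁ - C₂ * g') (hC₂ : 0 ≤ C₂)
    (hg' : 0 ≤ g') (hg : 2 * g' ≤ g) (hy : 0 ≤ y) (ht : 0 ≤ t) (hD : 0 ≤ D)
    (h1 : C₁ * t ≤ w + C₂ * (g' * t + g * y))
    (h2 : d ≤ t + (g' * t + g * y)) (hw : w ^ 2 ≤ D * (t + y)) :
    d ≤ (2 * (C₂ * g / ρ) + 3 / 2) * (g + 1) * y + (g' + 1) * (4 * (D / ρ ^ 2)) := by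
  -- The arithmetic-geometric mean inequality, weighted so that only half of `ρ * t` is spent.
  have hw2 : w ≤ D / (2 * ρ) + ρ * (t + y) / 2 := by
    refine abs_le_of_sq_le_sq' (hw.trans ?_) (by positivity) |>.2
    have e : (D / (2 * ρ) + ρ * (t + y) / 2) ^ 2 =
        D * (t + y) + (D / (2 * ρ) - ρ * (t + y) / 2) ^ 2 := by
      field_simp; ring
    rw [e]
    exact le_add_of_nonneg_right (sq_nonneg _)
  have h3 : t ≤ D / ρ ^ 2 + y + 2 * (C₂ * g / ρ) * y := by
    have h4 : ρ * t / 2 ≤ D / (2 * ρ) + ρ * y / 2 + C₂ * g * y := by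
      rw [hρe] at hw2 ⊢; linarith
    have h5 : t = (ρ * t / 2) * (2 / ρ) := by field_simp
    have e : D / ρ ^ 2 + y + 2 * (C₂ * g / ρ) * y =
        (D / (2 * ρ) + ρ * y / 2 + C₂ * g * y) * (2 / ρ) := by field_simp
    rw [h5, e]
    exact mul_le_mul_of_nonneg_right h4 (by positivity)
  have hg0 : 0 ≤ g := by linarith
  have h4 : d ≤ (1 + g') * (D / ρ ^ 2 + y + 2 * (C₂ * g / ρ) * y) + g * y := by
    have := mul_le_mul_of_nonneg_left h3 (show 0 ≤ 1 + g' by linarith)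
    linarith
  have h5 : (1 + g') * (C₂ * g / ρ * y) ≤ (1 + g) * (C₂ * g / ρ * y) :=
    mul_le_mul_of_nonneg_right (by linarith) (by positivity)
  -- The argument gives `D / ρ ^ 2`; the factor `4` is slack matching the stated constant.
  have h6 : (1 + g') * (D / ρ ^ 2) ≤ (1 + g') * (4 * (D / ρ ^ 2)) := by
    have : 0 ≤ D / ρ ^ 2 := by positivity
    exact mul_le_mul_of_nonneg_left (by linarith) (by linarith)
  -- The origin of `3 / 2`: the remaining coefficient of `y` is `1 + g' + g`, at most `3 / 2 * (g +
  -- 1)`.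
  have h7 : 2 * g' * y ≤ g * y := mul_le_mul_of_nonneg_right hg hy
  linarith

theorem sub_mul_inv_pos_of_div_lt {x : ℝ} (hC₁ : 0 < C₁) (hx : 0 < x) (h : C₂ / C₁ < x) :
    0 < C₁ - C₂ * x⁻¹ := by
  rw [div_lt_iff₀ hC₁] at h
  rw [sub_pos, ← div_eq_mul_inv, div_lt_iff₀ hx]
  linarith

end algebra

/-! ### Recovery guarantees -/

/-- The source of the contraction factor `a`: the block gain in `s` meets the Hölder loss in `r`,
and only their ratio `k` survives. -/
theorem rpow_neg_mul_rpow_eq {k e : ℝ} {r s : ℕ} (hk : 0 < k) (hr : 0 < r)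
    (hs : (s : ℝ) = k * r) : (s : ℝ) ^ (-e) * (r : ℝ) ^ e = (1 / k) ^ e := by
  have hr' : (0 : ℝ) < r := by exact_mod_cast hr
  rw [hs, Real.mul_rpow hk.le hr'.le, mul_assoc, ← Real.rpow_add hr', neg_add_cancel,
    Real.rpow_zero, mul_one, one_div, Real.inv_rpow hk.le, Real.rpow_neg hk.le]

section recovery

variable {m N : ℕ} {A : Fin N → Matrix (Fin m) (Fin m) ℝ} {p q k : ℝ} {r s : ℕ} {C₁ C₂ : ℝ}

/-- The error bounds for a low-rank target. -/
theorem SymmRUB.low_rank_error_bounds (hA : SymmRUB A q (s + r) C₁ C₂) (hp : 0 < p) (hpq : p ≤ q)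
    (hq1 : q ≤ 1) (hr : 0 < r) (hk : 0 < k) (hs : (s : ℝ) = k * r) (hC₂ : 0 ≤ C₂)
    {X Y : Matrix (Fin m) (Fin m) ℝ} (hX : X.IsSymm) (hY : Y.IsSymm)
    (hmin : schatten p Y ^ p ≤ schatten p X ^ p) (hXr : X.rank ≤ r) :
    ∃ t P : ℝ, 0 ≤ t ∧ 0 ≤ P ∧ P ^ (q / p) ≤ (r : ℝ) ^ ((1 / p - 1 / 2) * q) * t ∧
      schatten 2 (Y - X) ^ q ≤ ((1 / k) ^ ((1 / p - 1 / 2) * q) + 1) * t ∧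
      (C₁ - C₂ * (1 / k) ^ ((1 / p - 1 / 2) * q)) * t ≤
        lqNorm q (measOp A (Y - X)) ^ q / N ∧
      ∑ i : Fin m, singVal (Y - X) i ≤ (2 * P) ^ (1 / p) := by
  have hs0 : 0 < s := by
    have hr' : (0 : ℝ) < r := by exact_mod_cast hr
    have : (0 : ℝ) < s := by rw [hs]; positivity
    exact_mod_cast this
  -- The approximant `Z` is `X` itself, so the approximation terms vanish.
  obtain ⟨t, P, ht, hP, h1, h2, h3, h4⟩ :=
    hA.error_bounds hp hpq hq1 hr hs0 hC₂ hX hY hmin hXr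
  rw [sub_self, schatten_zero hp, Real.zero_rpow hp.ne'] at h2 h3 h4
  rw [mul_zero, add_zero] at h2 h3
  rw [add_zero] at h4
  have hKR := rpow_neg_mul_rpow_eq (e := (1 / p - 1 / 2) * q) hk hr hs
  have h5 : (s : ℝ) ^ (-((1 / p - 1 / 2) * q)) * P ^ (q / p) ≤
      (1 / k) ^ ((1 / p - 1 / 2) * q) * t := by
    rw [← hKR, mul_assoc]
    exact mul_le_mul_of_nonneg_left h1 (by positivity)
  refine ⟨t, P, ht, hP, h1, by linarith, ?_, h4⟩
  have := mul_le_mul_of_nonneg_left h5 hC₂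
  linarith

/-- A symmetric matrix of low rank is the only matrix with the same measurements and no larger
Schatten norm. -/
theorem SymmRUB.eq_of_schatten_le (hA : SymmRUB A q (s + r) C₁ C₂) (hp : 0 < p) (hpq : p ≤ q)
    (hq1 : q ≤ 1) (hr : 0 < r) (hk : 0 < k) (hs : (s : ℝ) = k * r) (hC₂ : 0 ≤ C₂)
    (hρ : 0 < C₁ - C₂ * (1 / k) ^ ((1 / p - 1 / 2) * q))
    {X Y : Matrix (Fin m) (Fin m) ℝ} (hX : X.IsSymm) (hY : Y.IsSymm)
    (hmin : schatten p Y ^ p ≤ schatten p X ^ p) (hXr : X.rank ≤ r)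
    (hXY : measOp A Y = measOp A X) : Y = X := by
  have hq : 0 < q := hp.trans_le hpq
  obtain ⟨t, P, ht, hP, -, h2, h3, -⟩ :=
    hA.low_rank_error_bounds hp hpq hq1 hr hk hs hC₂ hX hY hmin hXr
  rw [map_sub, hXY, sub_self, lqNorm_zero_rpow hq, zero_div] at h3
  have ht0 : t = 0 := le_antisymm (by by_contra h; push Not at h; nlinarith) ht
  rw [ht0, mul_zero] at h2
  exact sub_eq_zero.1 (eq_zero_of_schatten_two_rpow_le_zero hq (hY.sub hX) h2)

theorem SymmRUB.low_rank_recovery (hA : SymmRUB A q (s + r) C₁ C₂) (hp : 0 < p) (hpq : p ≤ q)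
    (hq1 : q ≤ 1) (hr : 0 < r) (hk : 0 < k) (hs : (s : ℝ) = k * r) (hC₂ : 0 ≤ C₂) (hN : 0 < N)
    {ρ : ℝ} (hρ : 0 < ρ) (hρe : ρ = C₁ - C₂ * (1 / k) ^ ((1 / p - 1 / 2) * q)) {η₁ η₂ : ℝ}
    {b : Fin N → ℝ} {X Y : Matrix (Fin m) (Fin m) ℝ} (hX : X.IsSymm) (hY : Y.IsSymm)
    (hmin : schatten p Y ^ p ≤ schatten p X ^ p) (hXr : X.rank ≤ r)
    (hbX : b - measOp A X ∈ lqBall N q η₁ ∩ dantzigBall A η₂)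
    (hbY : b - measOp A Y ∈ lqBall N q η₁ ∩ dantzigBall A η₂) :
    schatten 2 (Y - X) ^ q ≤
      ((1 / k) ^ ((1 / p - 1 / 2) * q) + 1) * (1 / (ρ * (N : ℝ) ^ q)) *
        min (2 / (N : ℝ) ^ (1 - 2 * q) * η₁ ^ q)
          (2 ^ (q / p + q) / ρ * (r : ℝ) ^ ((1 / p - 1 / 2) * q) * η₂ ^ q) := by
  have hq : 0 < q := hp.trans_le hpq
  have hN' : (0 : ℝ) < N := by exact_mod_cast hN
  obtain ⟨t, P, ht, hP, h1, h2, h3, h4⟩ :=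
    hA.low_rank_error_bounds hp hpq hq1 hr hk hs hC₂ hX hY hmin hXr
  rw [← hρe] at h3
  have hw1 := lqNorm_measOp_sub_div_le hq hq1 hN hbX.1 hbY.1
  have hw2 := sq_lqNorm_measOp_sub_div_le (p := p) hq hq1 hN hX hY hbX.2 hbY.2
    (by positivity) h4
  have hη : 0 ≤ η₂ := (schattenInf_nonneg _).trans hbX.2
  refine h2.trans ?_
  rw [mul_assoc]
  refine mul_le_mul_of_nonneg_left ?_ (by positivity)
  rw [mul_min_of_nonneg _ _ (by positivity)]
  refine le_min ?_ ?_
  · have e : 1 / (ρ * (N : ℝ) ^ q) * (2 / (N : ℝ) ^ (1 - 2 * q) * η₁ ^ q) =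
        1 / (N : ℝ) ^ q * (2 / (N : ℝ) ^ (1 - 2 * q) * η₁ ^ q) / ρ := by
      field_simp
    rw [e, le_div_iff₀ hρ, mul_comm]
    exact h3.trans hw1
  · have h5 : (2 * P) ^ (q / p) ≤ 2 ^ (q / p) * ((r : ℝ) ^ ((1 / p - 1 / 2) * q) * t) := by
      rw [Real.mul_rpow zero_le_two hP]
      exact mul_le_mul_of_nonneg_left h1 (by positivity)
    set D := 1 / (N : ℝ) ^ q * (2 ^ q * η₂ ^ q *
      (2 ^ (q / p) * (r : ℝ) ^ ((1 / p - 1 / 2) * q))) with hD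
    have hw3 : (lqNorm q (measOp A (Y - X)) ^ q / N) ^ 2 ≤ D * t := by
      refine hw2.trans ?_
      have e : D * t = 1 / (N : ℝ) ^ q * (2 ^ q * η₂ ^ q *
          (2 ^ (q / p) * ((r : ℝ) ^ ((1 / p - 1 / 2) * q) * t))) := by rw [hD]; ring
      rw [e]
      gcongr
    have h6 := le_of_sq_le_mul_self hρ ht h3 hw3 (by positivity)
    refine h6.trans (le_of_eq ?_)
    rw [hD, Real.rpow_add two_pos]
    field_simp

theorem SymmRUB.general_recovery (hA : SymmRUB A q (s + r) C₁ C₂) (hp : 0 < p) (hpq : p ≤ q)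
    (hq1 : q ≤ 1) (hr : 0 < r) (hk : 0 < k) (hs : (s : ℝ) = k * r) (hC₂ : 0 ≤ C₂) (hN : 0 < N)
    {ρ : ℝ} (hρ : 0 < ρ)
    (hρe : ρ = C₁ - C₂ * 2 ^ (q / p - 1) * (1 / k) ^ ((1 / p - 1 / 2) * q)) {η₁ η₂ : ℝ}
    {b : Fin N → ℝ} {X Y Z : Matrix (Fin m) (Fin m) ℝ} (hX : X.IsSymm) (hY : Y.IsSymm)
    (hmin : schatten p Y ^ p ≤ schatten p X ^ p) (hZ : Z.rank ≤ r)
    (hbX : b - measOp A X ∈ lqBall N q η₁ ∩ dantzigBall A η₂)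
    (hbY : b - measOp A Y ∈ lqBall N q η₁ ∩ dantzigBall A η₂) :
    schatten 2 (Y - X) ^ q ≤
      min
        ((C₂ * 2 ^ (2 * q / p - 1) / ρ * (1 / k) ^ ((1 / p - 1 / 2) * q) + 1) *
            (2 ^ (2 * q / p - 1) * (1 / k) ^ ((1 / p - 1 / 2) * q) + 1) *
            (schatten p (X - Z) / (r : ℝ) ^ (1 / p - 1 / 2)) ^ q +
          (2 ^ (q / p - 1) * (1 / k) ^ ((1 / p - 1 / 2) * q) + 1) *
            (1 / (ρ * (N : ℝ) ^ q)) *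
            (2 / (N : ℝ) ^ (1 - 2 * q) * η₁ ^ q))
        ((C₂ * 2 ^ (2 * q / p) / ρ * (1 / k) ^ ((1 / p - 1 / 2) * q) + 3 / 2) *
            (2 ^ (2 * q / p - 1) * (1 / k) ^ ((1 / p - 1 / 2) * q) + 1) *
            (schatten p (X - Z) / (r : ℝ) ^ (1 / p - 1 / 2)) ^ q +
          (2 ^ (q / p - 1) * (1 / k) ^ ((1 / p - 1 / 2) * q) + 1) *
            (1 / (ρ * (N : ℝ) ^ q)) *
            (2 ^ (2 * q / p + q + 1) / ρ * (r : ℝ) ^ ((1 / p - 1 / 2) * q) * η₂ ^ q)) := by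
  have hq : 0 < q := hp.trans_le hpq
  have hN' : (0 : ℝ) < N := by exact_mod_cast hN
  have hr' : (0 : ℝ) < r := by exact_mod_cast hr
  have hs0 : 0 < s := by
    have : (0 : ℝ) < s := by rw [hs]; positivity
    exact_mod_cast this
  have hqp : 1 ≤ q / p := (one_le_div hp).2 hpq
  have hη : 0 ≤ η₂ := (schattenInf_nonneg _).trans hbX.2
  obtain ⟨t, P, ht, hP, h1, h2, h3, h4⟩ :=
    hA.error_bounds hp hpq hq1 hr hs0 hC₂ hX hY hmin hZ
  have hT0 := schatten_nonneg p (X - Z)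
  have hw1 := lqNorm_measOp_sub_div_le hq hq1 hN hbX.1 hbY.1
  have hw2 := sq_lqNorm_measOp_sub_div_le (p := p) hq hq1 hN hX hY hbX.2 hbY.2
    (by positivity) h4
  have hKR := rpow_neg_mul_rpow_eq (e := (1 / p - 1 / 2) * q) hk hr hs
  set y := (schatten p (X - Z) / (r : ℝ) ^ (1 / p - 1 / 2)) ^ q with hy
  have hy0 : 0 ≤ y := by positivity
  set T := schatten p (X - Z) ^ p with hT
  have hT0 : 0 ≤ T := by positivity
  set R := (r : ℝ) ^ ((1 / p - 1 / 2) * q) with hR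
  have hR0 : 0 < R := by positivity
  set K := (s : ℝ) ^ (-((1 / p - 1 / 2) * q)) with hK
  have hK0 : 0 ≤ K := by positivity
  set a := (1 / k) ^ ((1 / p - 1 / 2) * q) with ha
  have ha0 : 0 ≤ a := by positivity
  have hTR : T ^ (q / p) = R * y := by
    rw [hT, hy, hR, ← Real.rpow_mul (schatten_nonneg p _), mul_div_cancel₀ _ hp.ne',
      Real.div_rpow (schatten_nonneg p _) (by positivity), ← Real.rpow_mul hr'.le,
      mul_div_cancel₀]
    positivity
  have two1 : (2 : ℝ) ^ (2 * q / p - 1) = 2 ^ (q / p) * 2 ^ (q / p - 1) := by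
    rw [← Real.rpow_add two_pos]; congr 1; ring
  have two2 : (2 : ℝ) ^ (2 * q / p) = 2 * 2 ^ (2 * q / p - 1) := by
    rw [Real.rpow_sub_one two_ne_zero]; ring
  have two3 : (2 : ℝ) ^ (2 * q / p + q + 1) = 4 * (2 ^ q * 2 ^ (2 * q / p - 1)) := by
    rw [Real.rpow_add two_pos, Real.rpow_add two_pos, two2, Real.rpow_one]; ring
  have two4 : (2 : ℝ) ≤ 2 ^ (q / p) := by
    simpa using Real.rpow_le_rpow_of_exponent_le one_le_two hqp
  -- Convexity of `u ^ (q / p)` contributes `2 ^ (q / p - 1)`, and the `2` in front of `T` a further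
  -- `2 ^ (q / p)`.
  have h5 : K * (P + 2 * T) ^ (q / p) ≤
      (2 ^ (q / p - 1) * a) * t + (2 ^ (2 * q / p - 1) * a) * y := by
    have i1 := add_rpow_le_two_rpow_mul hP (show 0 ≤ 2 * T by positivity) hqp
    rw [Real.mul_rpow zero_le_two hT0, hTR] at i1
    have i2 : (P + 2 * T) ^ (q / p) ≤ 2 ^ (q / p - 1) * (R * t + 2 ^ (q / p) * (R * y)) :=
      i1.trans (mul_le_mul_of_nonneg_left (by linarith) (by positivity))
    refine (mul_le_mul_of_nonneg_left i2 hK0).trans (le_of_eq ?_)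
    rw [two1, ← hKR]; ring
  have h6 : (2 * (P + T)) ^ (q / p) ≤ 2 ^ (2 * q / p - 1) * R * (t + y) := by
    have i1 := add_rpow_le_two_rpow_mul hP hT0 hqp
    rw [hTR] at i1
    rw [Real.mul_rpow zero_le_two (by positivity), two1]
    have i2 : (P + T) ^ (q / p) ≤ 2 ^ (q / p - 1) * (R * t + R * y) :=
      i1.trans (mul_le_mul_of_nonneg_left (by linarith) (by positivity))
    refine (mul_le_mul_of_nonneg_left i2 (by positivity)).trans (le_of_eq ?_)
    ring
  have g1 : C₁ * t ≤ lqNorm q (measOp A (Y - X)) ^ q / N +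
      C₂ * ((2 ^ (q / p - 1) * a) * t + (2 ^ (2 * q / p - 1) * a) * y) :=
    h3.trans (add_le_add_right (mul_le_mul_of_nonneg_left h5 hC₂) _)
  have g2 := h2.trans (add_le_add_right h5 t)
  have hgg : 2 * (2 ^ (q / p - 1) * a) ≤ 2 ^ (2 * q / p - 1) * a := by
    rw [two1, ← mul_assoc]
    exact mul_le_mul_of_nonneg_right (mul_le_mul_of_nonneg_right two4 (by positivity)) ha0
  have hg0 : (0 : ℝ) ≤ 2 ^ (q / p - 1) * a := by positivity
  rw [mul_assoc C₂] at hρe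
  refine le_min ?_ ?_
  · refine (general_lq_bound hρ hρe hC₂ hg0 (by linarith) hy0 g1 g2 hw1).trans (le_of_eq ?_)
    field_simp
  · set D := 1 / (N : ℝ) ^ q * (2 ^ q * η₂ ^ q * (2 ^ (2 * q / p - 1) * R)) with hD
    have hw3 : (lqNorm q (measOp A (Y - X)) ^ q / N) ^ 2 ≤ D * (t + y) := by
      refine hw2.trans ?_
      have e : D * (t + y) = 1 / (N : ℝ) ^ q * (2 ^ q * η₂ ^ q *
          (2 ^ (2 * q / p - 1) * R * (t + y))) := by rw [hD]; ring
      rw [e]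
      gcongr
    refine (general_dantzig_bound hρ hρe hC₂ hg0 hgg hy0 ht (by positivity) g1 g2 hw3).trans
      (le_of_eq ?_)
    rw [two3, two2, hD]
    field_simp

end recovery
-- The main theorem
theorem mainTheorem8 {m L : ℕ} (β : Fin L → Fin m → ℝ)
    (p q : ℝ) (hp : 0 < p) (hpq : p ≤ q) (hq : q ≤ 1)
    (r : ℕ) (hr : 0 < r) (k : ℝ) (hk : 1 < k) (s : ℕ) (hs : (s : ℝ) = k * r)
    (C₁ C₂ : ℝ) (hC₁ : 0 < C₁)
    (hRUB : SymmRUB (debias (srop β)) q (s + r) C₁ C₂)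
    (ρ₁ ρ₂ : ℝ)
    (hρ₁ : ρ₁ = C₁ - C₂ * (1 / k) ^ ((1 / p - 1 / 2) * q))
    (hρ₂ : ρ₂ = C₁ - C₂ * 2 ^ (q / p - 1) * (1 / k) ^ ((1 / p - 1 / 2) * q)) :
    -- exact recovery from noiseless measurements
    (C₂ / C₁ < k ^ ((1 / p - 1 / 2) * q) →
      ∀ (X : Matrix (Fin m) (Fin m) ℝ) (b : Fin L → ℝ), X.IsSymm → X.rank ≤ r →
        debias b = measOp (debias (srop β)) X →
        ∀ Xhat : Matrix (Fin m) (Fin m) ℝ,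
          IsSchattenMin (debias (srop β)) (debias b) {0} p Xhat ↔ Xhat = X) ∧
    -- stable recovery of symmetric matrices of rank at most `r`
    (C₂ / C₁ < k ^ ((1 / p - 1 / 2) * q) →
      ∀ (η₁ η₂ : ℝ) (X : Matrix (Fin m) (Fin m) ℝ) (b : Fin L → ℝ), X.IsSymm → X.rank ≤ r →
        debias b - measOp (debias (srop β)) X ∈
          lqBall (L / 2) q η₁ ∩ dantzigBall (debias (srop β)) η₂ →
        ∀ Xhat : Matrix (Fin m) (Fin m) ℝ,
          IsSchattenMin (debias (srop β)) (debias b)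
            (lqBall (L / 2) q η₁ ∩ dantzigBall (debias (srop β)) η₂) p Xhat →
          schatten 2 (Xhat - X) ^ q ≤
            ((1 / k) ^ ((1 / p - 1 / 2) * q) + 1) * (1 / (ρ₁ * ((L / 2 : ℕ) : ℝ) ^ q)) *
              min (2 / ((L / 2 : ℕ) : ℝ) ^ (1 - 2 * q) * η₁ ^ q)
                (2 ^ (q / p + q) / ρ₁ * (r : ℝ) ^ ((1 / p - 1 / 2) * q) * η₂ ^ q)) ∧
    -- stable recovery of general symmetric matrices
    (2 ^ (2 * (q - p) / (q * (2 - p))) < k →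
      C₂ / C₁ < 2 ^ (1 - q / p) * k ^ ((1 / p - 1 / 2) * q) →
      ∀ (η₁ η₂ : ℝ) (X Xr : Matrix (Fin m) (Fin m) ℝ) (b : Fin L → ℝ), X.IsSymm →
        IsBestRankApprox r X Xr →
        debias b - measOp (debias (srop β)) X ∈
          lqBall (L / 2) q η₁ ∩ dantzigBall (debias (srop β)) η₂ →
        ∀ Xhat : Matrix (Fin m) (Fin m) ℝ,
          IsSchattenMin (debias (srop β)) (debias b)
            (lqBall (L / 2) q η₁ ∩ dantzigBall (debias (srop β)) η₂) p Xhat →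
          schatten 2 (Xhat - X) ^ q ≤
            min
              ((C₂ * 2 ^ (2 * q / p - 1) / ρ₂ * (1 / k) ^ ((1 / p - 1 / 2) * q) + 1) *
                  (2 ^ (2 * q / p - 1) * (1 / k) ^ ((1 / p - 1 / 2) * q) + 1) *
                  (schatten p (X - Xr) / (r : ℝ) ^ (1 / p - 1 / 2)) ^ q +
                (2 ^ (q / p - 1) * (1 / k) ^ ((1 / p - 1 / 2) * q) + 1) *
                  (1 / (ρ₂ * ((L / 2 : ℕ) : ℝ) ^ q)) *
                  (2 / ((L / 2 : ℕ) : ℝ) ^ (1 - 2 * q) * η₁ ^ q))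
              ((C₂ * 2 ^ (2 * q / p) / ρ₂ * (1 / k) ^ ((1 / p - 1 / 2) * q) + 3 / 2) *
                  (2 ^ (2 * q / p - 1) * (1 / k) ^ ((1 / p - 1 / 2) * q) + 1) *
                  (schatten p (X - Xr) / (r : ℝ) ^ (1 / p - 1 / 2)) ^ q +
                (2 ^ (q / p - 1) * (1 / k) ^ ((1 / p - 1 / 2) * q) + 1) *
                  (1 / (ρ₂ * ((L / 2 : ℕ) : ℝ) ^ q)) *
                  (2 ^ (2 * q / p + q + 1) / ρ₂ * (r : ℝ) ^ ((1 / p - 1 / 2) * q) * η₂ ^ q))) := by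
  have hq0 : 0 < q := hp.trans_le hpq
  have hk0 : 0 < k := zero_lt_one.trans hk
  -- For `m = 0` RUB is vacuous and says nothing about `C₂` or the number of measurements. All
  -- matrices then coincide, and the error bounds need only a nonnegative right-hand side.
  have hcases : m = 0 ∨ (0 ≤ C₂ ∧ 0 < L / 2) := by
    rcases Nat.eq_zero_or_pos m with h | h
    · exact Or.inl h
    · exact Or.inr (hRUB.nonneg_and_pos h (by omega) hC₁)
  have hke : (1 / k) ^ ((1 / p - 1 / 2) * q) = (k ^ ((1 / p - 1 / 2) * q))⁻¹ := by
    rw [one_div, Real.inv_rpow hk0.le]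
  have hpos₁ : C₂ / C₁ < k ^ ((1 / p - 1 / 2) * q) → 0 < ρ₁ := fun h => by
    rw [hρ₁, hke]
    exact sub_mul_inv_pos_of_div_lt hC₁ (by positivity) h
  have hpos₂ : C₂ / C₁ < 2 ^ (1 - q / p) * k ^ ((1 / p - 1 / 2) * q) → 0 < ρ₂ := fun h => by
    have e : (2 : ℝ) ^ (q / p - 1) = (2 ^ (1 - q / p))⁻¹ := by
      rw [← Real.rpow_neg zero_le_two, neg_sub]
    rw [hρ₂, hke, e, mul_assoc, ← mul_inv]
    exact sub_mul_inv_pos_of_div_lt hC₁ (by positivity) h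
  refine ⟨fun hC X b hX hXr hb Xhat => ?_, fun hC η₁ η₂ X b hX hXr hbX Xhat hmin => ?_,
    fun _ hC η₁ η₂ X Xr b hX hXr hbX Xhat hmin => ?_⟩
  · have huniq : ∀ Y : Matrix (Fin m) (Fin m) ℝ, Y.IsSymm →
        debias b - measOp (debias (srop β)) Y ∈ ({0} : Set (Fin (L / 2) → ℝ)) →
        schatten p Y ^ p ≤ schatten p X ^ p → Y = X := by
      intro Y hY hYb hle
      rcases hcases with rfl | ⟨hC₂, -⟩
      · exact Subsingleton.elim _ _
      · refine hRUB.eq_of_schatten_le hp hpq hq hr hk0 hs hC₂ (hρ₁ ▸ hpos₁ hC) hX hY hle hXr ?_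
        rw [← hb]
        exact (sub_eq_zero.1 hYb).symm
    have hfeas : debias b - measOp (debias (srop β)) X ∈ ({0} : Set (Fin (L / 2) → ℝ)) :=
      sub_eq_zero.2 hb
    constructor
    · rintro ⟨h1, h2, h3⟩
      exact huniq Xhat h1 h2 (h3 X hX hfeas)
    · rintro rfl
      refine ⟨hX, hfeas, fun Y hY hYb => ?_⟩
      -- A feasible competitor with strictly smaller norm would equal `X` by uniqueness.
      by_contra h
      exact h (le_of_eq (by rw [huniq Y hY hYb (not_le.1 h).le]))
  · have hρ := hpos₁ hC
    rcases hcases with rfl | ⟨hC₂, hN⟩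
    · have hη₂ : 0 ≤ η₂ := (schattenInf_nonneg _).trans hbX.2
      have hη₁ : 0 ≤ η₁ := (div_nonneg (lqNorm_nonneg _ _) (Nat.cast_nonneg _)).trans hbX.1
      rw [Subsingleton.elim (Xhat - X) 0, schatten_zero two_pos, Real.zero_rpow hq0.ne']
      positivity
    · exact hRUB.low_rank_recovery hp hpq hq hr hk0 hs hC₂ hN hρ hρ₁ hX hmin.1
        (hmin.2.2 X hX hbX) hXr hbX hmin.2.1
  · have hρ := hpos₂ hC
    rcases hcases with rfl | ⟨hC₂, hN⟩
    · have hη₂ : 0 ≤ η₂ := (schattenInf_nonneg _).trans hbX.2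
      have hη₁ : 0 ≤ η₁ := (div_nonneg (lqNorm_nonneg _ _) (Nat.cast_nonneg _)).trans hbX.1
      -- The approximation term vanishes as well, which removes the coefficient containing `C₂`,
      -- whose sign is unknown here.
      rw [Subsingleton.elim (Xhat - X) 0, Subsingleton.elim (X - Xr) 0, schatten_zero two_pos,
        schatten_zero hp, zero_div, Real.zero_rpow hq0.ne', mul_zero, mul_zero, zero_add, zero_add]
      positivity
    · exact hRUB.general_recovery hp hpq hq hr hk0 hs hC₂ hN hρ hρ₂ hX hmin.1
        (hmin.2.2 X hX hbX) hXr.1 hbX hmin.2.1
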